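/- Let $\mathbb E^5_2$ be $\mathbb R^5$ with the metric $\langle v,w\rangle=-v_1w_1-v_2w_2+v_3w_3+v_4w_4+v_5w_5$, and let $\mathbb S^4_2(1)=\{v\in\mathbb E^5_2:\langle v,v\rangle=1\}$. Let $M$ be a non-empty oriented smooth surface, and let $x:M\to\mathbb S^4_2(1)\subset\mathbb E^5_2$ be a smooth immersion whose induced metric is Lorentzian, and which is minimal in $\mathbb S^4_2(1)$, i.e. its mean curvature vector $\frac12\operatorname{tr}\hat h$ vanishes identically, where $\hat h$ is the second fundamental form of $M$ in $\mathbb S^4_2(1)$. Let $$K=\frac{\langle R(X,Y)Y,X\rangle}{\langle X,X\rangle\langle Y,Y\rangle-\langle X,Y\rangle^2}$$ be the Gaussian curvature of $M$, where $R$ is the curvature tensor of the Levi-Civita connection of the induced metric and $X,Y$ span the tangent plane. Let $K^D=-\langle R^{\hat D}(f_1,f_2)f_3,f_4\rangle$ be the normal curvature of $M$ in $\mathbb S^4_2(1)$, where $R^{\hat D}$ is the curvature tensor of the normal connection $\hat D$ of $M$ in $\mathbb S^4_2(1)$, and $\{f_1,f_2;f_3,f_4\}$ is any positively oriented pseudo-orthonormal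 frame: $f_1,f_2$ are tangent to $M$, $f_3,f_4$ are normal to $M$ in $\mathbb S^4_2(1)$, $\langle f_1,f_2\rangle=\langle f_3,f_4\rangle=-1$, all other products $\langle f_A,f_B\rangle$ vanish, $(f_1,f_2)$ is positive for the orientation of $M$, and $(f_1,f_2,f_3,f_4,x)$ is a positive basis of $\mathbb R^5$. If $K$ and $K^D$ are both constant on $M$ and $K^D\neq0$, then $K=\frac13$ and $|K^D|=\frac23$. -/

import Mathlib

open scoped Manifold ContDiff

noncomputable section

namespace LorentzSurface

/-- The model plane of the coordinate charts of a surface. -/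
abbrev Plane : Type := EuclideanSpace ℝ (Fin 2)

/-- The underlying vector space of the pseudo-Euclidean space `𝔼⁵₂`. -/
abbrev E52 : Type := Fin 5 → ℝ

/-- The canonical metric of index `2` on `𝔼⁵₂`. -/
def inner52 (v w : E52) : ℝ :=
  -(v 0 * w 0) - v 1 * w 1 + v 2 * w 2 + v 3 * w 3 + v 4 * w 4

/-- The pseudo-sphere `𝕊⁴₂(1)`, of dimension `4`, index `2` and constant curvature `1`. -/
def S42 : Set E52 := {v | inner52 v v = 1}

/-- The partial derivative `∂ᵢ F` of a function of two real variables. -/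
def pd {V : Type*} [NormedAddCommGroup V] [NormedSpace ℝ V]
    (i : Fin 2) (F : Plane → V) (u : Plane) : V :=
  fderiv ℝ F u (EuclideanSpace.single i 1)

/-! ### Geometry of a parametrized surface `φ` in `𝕊⁴₂(1)`

In this part `φ : Plane → E52` is a smooth parametrization, defined near the point `u`, of a surface
in `𝕊⁴₂(1)`.  A tangent vector is given by its coordinates `a : Plane` with respect to `∂₀, ∂₁`;
it is identified with the vector `fderiv ℝ φ u a` of `𝔼⁵₂`. -/

/-- The induced metric on tangent vectors. -/
def firstForm (φ : Plane → E52) (u a b : Plane) : ℝ :=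
  inner52 (fderiv ℝ φ u a) (fderiv ℝ φ u b)

/-- The matrix `gᵢⱼ = ⟨∂ᵢφ, ∂ⱼφ⟩` of the induced metric. -/
def gram (φ : Plane → E52) (u : Plane) : Matrix (Fin 2) (Fin 2) ℝ :=
  Matrix.of fun i j => inner52 (pd i φ u) (pd j φ u)

/-- The induced metric at `u` is Lorentzian, i.e. nondegenerate of signature `(-,+)`: the tangent
plane has an orthonormal basis consisting of a time-like and a space-like vector. -/
def IsLorentzianAt (φ : Plane → E52) (u : Plane) : Prop :=
  ∃ a b : Plane, firstForm φ u a a = -1 ∧ firstForm φ u b b = 1 ∧ firstForm φ u a b = 0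

/-- The Christoffel symbols `Γᵏᵢⱼ = ½ ∑ₗ gᵏˡ (∂ᵢ gⱼₗ + ∂ⱼ gᵢₗ - ∂ₗ gᵢⱼ)` of the Levi-Civita connection
of the induced metric. -/
def christoffel (φ : Plane → E52) (k i j : Fin 2) (u : Plane) : ℝ :=
  (1 / 2) * ∑ l : Fin 2, (gram φ u)⁻¹ k l *
    (pd i (fun w => gram φ w j l) u + pd j (fun w => gram φ w i l) u
      - pd l (fun w => gram φ w i j) u)

/-- The Levi-Civita covariant derivative `∇_{∂ᵢ} V` of the tangent vector field `V = ∑ Vᵏ ∂ₖ`: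
`(∇ᵢ V)ᵏ = ∂ᵢ Vᵏ + ∑ⱼ Γᵏᵢⱼ Vʲ`. -/
def covDeriv (φ : Plane → E52) (i : Fin 2) (V : Plane → Fin 2 → ℝ) (u : Plane) : Fin 2 → ℝ :=
  fun k => pd i (fun w => V w k) u + ∑ j : Fin 2, christoffel φ k i j u * V u j

/-- The components of `R(∂ᵢ, ∂ⱼ)∂ₖ = ∇ᵢ∇ⱼ∂ₖ - ∇ⱼ∇ᵢ∂ₖ`. -/
def riemann (φ : Plane → E52) (i j k : Fin 2) (u : Plane) : Fin 2 → ℝ :=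
  covDeriv φ i (covDeriv φ j fun _ => Pi.single k 1) u
    - covDeriv φ j (covDeriv φ i fun _ => Pi.single k 1) u

/-- The Gaussian curvature `K = ⟨R(X,Y)Y, X⟩ / (⟨X,X⟩⟨Y,Y⟩ - ⟨X,Y⟩²)`, for `X = ∂₀`, `Y = ∂₁`. -/
def gaussK (φ : Plane → E52) (u : Plane) : ℝ :=
  (∑ l : Fin 2, riemann φ 0 1 1 u l * gram φ u l 0)
    / (gram φ u 0 0 * gram φ u 1 1 - gram φ u 0 1 ^ 2)

/-- The second fundamental form `h(∂ᵢ, ∂ⱼ)` of the surface in `𝕊⁴₂(1)`, from the Gauss formula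
`h(X,Y) = ∇̂_X Y - ∇_X Y`.  Here `∇̂_X Y = D_X Y + ⟨X,Y⟩ φ` is the Levi-Civita connection of
`𝕊⁴₂(1)`, with `D` the flat connection of `𝔼⁵₂`. -/
def secondForm (φ : Plane → E52) (i j : Fin 2) (u : Plane) : E52 :=
  (pd i (pd j φ) u + gram φ u i j • φ u) - ∑ k : Fin 2, christoffel φ k i j u • pd k φ u

/-- The mean curvature vector `½ tr h` of the surface in `𝕊⁴₂(1)`. -/
def meanCurv (φ : Plane → E52) (u : Plane) : E52 :=
  (1 / 2 : ℝ) • ∑ i : Fin 2, ∑ j : Fin 2, (gram φ u)⁻¹ i j • secondForm φ i j u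

/-- The orthogonal projection of `𝔼⁵₂` onto the normal plane of the surface in `𝕊⁴₂(1)`, i.e. onto
the orthogonal complement of the span of `∂₀φ`, `∂₁φ` and of the position vector `φ`. -/
def normalProj (φ : Plane → E52) (u : Plane) (v : E52) : E52 :=
  v - inner52 v (φ u) • φ u
    - ∑ i : Fin 2, ∑ j : Fin 2, ((gram φ u)⁻¹ i j * inner52 v (pd i φ u)) • pd j φ u

/-- The normal connection `D̂_{∂ᵢ} ξ` of the surface in `𝕊⁴₂(1)`, for a normal vector field `ξ`. -/
def normalDeriv (φ : Plane → E52) (i : Fin 2) (ξ : Plane → E52) (u : Plane) : E52 :=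
  normalProj φ u (pd i ξ u)

/-- The curvature `R^D̂(a,b)ξ` of the normal connection, at tangent vectors `a`, `b` and a normal
vector `ξ` at `u`.  Being a tensor, it is computed with the coordinate fields `∂ᵢ`, which commute,
and with the normal field obtained by projecting the constant vector `ξ`. -/
def normalR (φ : Plane → E52) (u a b : Plane) (ξ : E52) : E52 :=
  ∑ i : Fin 2, ∑ j : Fin 2, (a i * b j) •
    (normalDeriv φ i (normalDeriv φ j fun w => normalProj φ w ξ) u
      - normalDeriv φ j (normalDeriv φ i fun w => normalProj φ w ξ) u)

/-- Positively oriented pseudo-orthonormal frames `{f₁, f₂; f₃, f₄}` at `u`: `f₁, f₂` are tangent,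
`f₃, f₄` are normal to the surface in `𝕊⁴₂(1)`, `⟨f₁,f₂⟩ = ⟨f₃,f₄⟩ = -1` and all other products
vanish; `(f₁, f₂)` is a positive basis of the tangent plane, and `(f₁, f₂, f₃, f₄, φ)` is a positive
basis of `𝔼⁵₂`. -/
structure PosNullFrame (φ : Plane → E52) (u : Plane) where
  /-- The first tangent null vector. -/
  f₁ : Plane
  /-- The second tangent null vector. -/
  f₂ : Plane
  /-- The first normal null vector. -/
  f₃ : E52
  /-- The second normal null vector. -/
  f₄ : E52
  tangent_11 : firstForm φ u f₁ f₁ = 0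
  tangent_22 : firstForm φ u f₂ f₂ = 0
  tangent_12 : firstForm φ u f₁ f₂ = -1
  normal_3 : ∀ a : Plane, inner52 f₃ (fderiv ℝ φ u a) = 0
  normal_4 : ∀ a : Plane, inner52 f₄ (fderiv ℝ φ u a) = 0
  normal_3_pos : inner52 f₃ (φ u) = 0
  normal_4_pos : inner52 f₄ (φ u) = 0
  normal_33 : inner52 f₃ f₃ = 0
  normal_44 : inner52 f₄ f₄ = 0
  normal_34 : inner52 f₃ f₄ = -1
  tangent_orient : 0 < f₁ 0 * f₂ 1 - f₁ 1 * f₂ 0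
  normal_orient :
    0 < (Matrix.of ![fderiv ℝ φ u f₁, fderiv ℝ φ u f₂, f₃, f₄, φ u]).det

open Classical in
/-- The normal curvature `K^D = -⟨R^D̂(f₁,f₂)f₃, f₄⟩` of the surface in `𝕊⁴₂(1)`, for a positively
oriented pseudo-orthonormal frame.  The value does not depend on the frame, because two such frames
differ by `(f₁, f₂, f₃, f₄) ↦ (c f₁, c⁻¹ f₂, d f₃, d⁻¹ f₄)`; a frame exists at every point of a
Lorentzian surface in `𝕊⁴₂(1)`. -/
def normalK (φ : Plane → E52) (u : Plane) : ℝ :=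
  if h : Nonempty (PosNullFrame φ u) then
    -inner52 (normalR φ u h.some.f₁ h.some.f₂ h.some.f₃) h.some.f₄
  else 0

/-! ### Surfaces -/

variable {M : Type*} [TopologicalSpace M] [ChartedSpace Plane M]

/-- The atlas of the surface `M` is oriented: all coordinate changes have positive Jacobian
determinant.  An oriented surface is a smooth surface given by such an atlas; the orientation
is the one for which the charts of the atlas are positive. -/
def IsOriented (M : Type*) [TopologicalSpace M] [ChartedSpace Plane M] : Prop :=
  ∀ e ∈ atlas Plane M, ∀ e' ∈ atlas Plane M, ∀ u ∈ (e.symm.trans e').source,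
    0 < (fderiv ℝ (e' ∘ e.symm) u).det

/-- The parametrization of (a part of) the immersed surface `x : M → 𝔼⁵₂` by the chart at `p`. -/
def param (x : M → E52) (p : M) : Plane → E52 := x ∘ (chartAt Plane p).symm

/-- `x : M → 𝔼⁵₂` is a Lorentzian surface in `𝕊⁴₂(1)`: a smooth map into `𝕊⁴₂(1)` whose induced
metric is Lorentzian at every point (in particular, `x` is an immersion). -/
structure IsLorentzianSurface (x : M → E52) : Prop where
  smooth : ContMDiff (𝓡 2) 𝓘(ℝ, E52) ∞ x
  mem_S42 : ∀ p, x p ∈ S42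
  lorentzian : ∀ p, IsLorentzianAt (param x p) (chartAt Plane p p)

/-- The mean curvature vector at `p` of the surface `x` in `𝕊⁴₂(1)`. -/
def meanCurvature (x : M → E52) (p : M) : E52 := meanCurv (param x p) (chartAt Plane p p)

/-- The surface `x` is minimal in `𝕊⁴₂(1)`: its mean curvature vector vanishes identically. -/
def IsMinimal (x : M → E52) : Prop := ∀ p, meanCurvature x p = 0

/-- The Gaussian curvature of the surface `x` at `p`. -/
def gaussianCurvature (x : M → E52) (p : M) : ℝ := gaussK (param x p) (chartAt Plane p p)

/-- The normal curvature at `p` of the surface `x` in `𝕊⁴₂(1)`. -/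
def normalCurvature (x : M → E52) (p : M) : ℝ := normalK (param x p) (chartAt Plane p p)

end LorentzSurface

end

/-!
A minimal Lorentzian surface in `𝕊⁴₂(1)` has `h(E₁, E₂) = 0` for tangent null fields `E₁, E₂` with
`⟨E₁, E₂⟩ = -1`, so its second fundamental form consists of two normal vectors
`h(E₁, E₁) = a F₃ + b F₄` and `h(E₂, E₂) = c F₃ + d F₄`, where `F₃, F₄` are normal null fields with
`⟨F₃, F₄⟩ = -1`.  Let `p, q` be the coframe, `dφ = p E₁ + q E₂`, and let `α`, `β` be the connection
forms of the tangent and of the normal bundle, `α = -⟨dE₁, E₂⟩` and `β = -⟨dF₃, F₄⟩`.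

* The curvatures are `K p ∧ q = -dα` and `K^D p ∧ q = dβ` (`gaussK_mul_coframe`,
  `normalK_mul_coframe`), and the equations of Gauss and Ricci give `K = 1 + a d + b c` and
  `K^D = a d - b c` (`gaussK_eq`, `normalK_eq`).  Hence `a d` and `b c` are constant.
* The Codazzi equations for `a` and `d` say that `da - 2 a α + a β` is a multiple of `p` and that
  `dd + 2 d α - d β` is a multiple of `q` (`codazzi`).  If `a d` is a nonzero constant, then
  `dd / d = - da / a`, so the first form, divided by `a`, is a multiple of both `p` and `q` and
  vanishes.  Differentiating `da / a = 2 α - β` gives `dβ = 2 dα`, that is `K^D = -2 K`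
  (`extD_normal_eq_two_mul`).
* Exchanging `F₃` and `F₄`, if `b c` is a nonzero constant, then `K^D = 2 K`.

As `K^D ≠ 0`, exactly one of `a d` and `b c` is nonzero, and the vanishing of the other one, which is
`K - 1 = K^D`, respectively `K - 1 = -K^D`, gives `K = 1/3` and `|K^D| = 2/3` (`curvatures_eq`).

The curvatures at a point of the surface are computed in the preferred chart of this point, which
varies with the point.  A smooth null frame is constructed in one chart (`exists_nullFrame`) and
pulled back to the other charts (`IsNullFrame.comp`); `a, b, c, d` do not change.
-/

open scoped Manifold ContDiff

namespace LorentzSurface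

/-! ### The metric of `𝔼⁵₂` and partial derivatives -/

theorem inner52_comm (v w : E52) : inner52 v w = inner52 w v := by
  simp only [inner52]; ring

theorem inner52_add_left (v w z : E52) : inner52 (v + w) z = inner52 v z + inner52 w z := by
  simp only [inner52, Pi.add_apply]; ring

theorem inner52_sub_left (v w z : E52) : inner52 (v - w) z = inner52 v z - inner52 w z := by
  simp only [inner52, Pi.sub_apply]; ring

theorem inner52_smul_left (c : ℝ) (v z : E52) : inner52 (c • v) z = c * inner52 v z := by
  simp only [inner52, Pi.smul_apply, smul_eq_mul]; ring

theorem inner52_add_right (v w z : E52) : inner52 z (v + w) = inner52 z v + inner52 z w := by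
  simp only [inner52, Pi.add_apply]; ring

theorem inner52_sub_right (v w z : E52) : inner52 z (v - w) = inner52 z v - inner52 z w := by
  simp only [inner52, Pi.sub_apply]; ring

theorem inner52_smul_right (c : ℝ) (v z : E52) : inner52 z (c • v) = c * inner52 z v := by
  simp only [inner52, Pi.smul_apply, smul_eq_mul]; ring

theorem inner52_zero_left (z : E52) : inner52 0 z = 0 := by
  simp [inner52]

theorem pd_congr {V : Type*} [NormedAddCommGroup V] [NormedSpace ℝ V] {F G : Plane → V}
    {u : Plane} (i : Fin 2) (h : F =ᶠ[nhds u] G) : pd i F u = pd i G u := by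
  simp only [pd, h.fderiv_eq]

theorem pd_add {V : Type*} [NormedAddCommGroup V] [NormedSpace ℝ V] {F G : Plane → V}
    {u : Plane} (i : Fin 2) (hF : DifferentiableAt ℝ F u) (hG : DifferentiableAt ℝ G u) :
    pd i (fun w => F w + G w) u = pd i F u + pd i G u := by
  simp only [pd]; rw [fderiv_fun_add hF hG]; rfl

theorem pd_smul {V : Type*} [NormedAddCommGroup V] [NormedSpace ℝ V] {r : Plane → ℝ}
    {G : Plane → V} {u : Plane} (i : Fin 2) (hr : DifferentiableAt ℝ r u)
    (hG : DifferentiableAt ℝ G u) :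
    pd i (fun w => r w • G w) u = r u • pd i G u + pd i r u • G u := by
  simp only [pd]; rw [fderiv_fun_smul hr hG]; simp

theorem pd_mul {r s : Plane → ℝ} {u : Plane} (i : Fin 2) (hr : DifferentiableAt ℝ r u)
    (hs : DifferentiableAt ℝ s u) :
    pd i (fun w => r w * s w) u = r u * pd i s u + pd i r u * s u :=
  pd_smul i hr hs

theorem pd_neg {r : Plane → ℝ} {u : Plane} (i : Fin 2) :
    pd i (fun w => -r w) u = -pd i r u := by
  simp only [pd]; rw [fderiv_fun_neg]; simp

theorem pd_inner52 {A B : Plane → E52} {u : Plane} (i : Fin 2) (hA : DifferentiableAt ℝ A u)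
    (hB : DifferentiableAt ℝ B u) :
    pd i (fun w => inner52 (A w) (B w)) u
      = inner52 (pd i A u) (B u) + inner52 (A u) (pd i B u) := by
  have hA' := fun k => hasFDerivAt_pi'.1 hA.hasFDerivAt k
  have hB' := fun k => hasFDerivAt_pi'.1 hB.hasFDerivAt k
  have h := (((((hA' 0).mul (hB' 0)).neg.sub ((hA' 1).mul (hB' 1))).add
    ((hA' 2).mul (hB' 2))).add ((hA' 3).mul (hB' 3))).add ((hA' 4).mul (hB' 4))
  have h' : HasFDerivAt (fun w => inner52 (A w) (B w)) _ u := h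
  simp only [pd]
  rw [h'.fderiv]
  simp [inner52]
  ring

theorem contDiffOn_inner52 {A B : Plane → E52} {U : Set Plane} (hA : ContDiffOn ℝ ∞ A U)
    (hB : ContDiffOn ℝ ∞ B U) : ContDiffOn ℝ ∞ (fun w => inner52 (A w) (B w)) U := by
  have hA' := fun k => contDiffOn_pi.1 hA k
  have hB' := fun k => contDiffOn_pi.1 hB k
  exact (((((hA' 0).mul (hB' 0)).neg.sub ((hA' 1).mul (hB' 1))).add
    ((hA' 2).mul (hB' 2))).add ((hA' 3).mul (hB' 3))).add ((hA' 4).mul (hB' 4))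

theorem contDiffOn_pd {V : Type*} [NormedAddCommGroup V] [NormedSpace ℝ V] {F : Plane → V}
    {U : Set Plane} (hU : IsOpen U) (hF : ContDiffOn ℝ ∞ F U) (i : Fin 2) :
    ContDiffOn ℝ ∞ (pd i F) U :=
  (hF.fderiv_of_isOpen hU (by simp)).clm_apply contDiffOn_const

theorem differentiableAt_of_contDiffOn {V : Type*} [NormedAddCommGroup V] [NormedSpace ℝ V]
    {F : Plane → V} {U : Set Plane} (hU : IsOpen U) (hF : ContDiffOn ℝ ∞ F U) {u : Plane}
    (hu : u ∈ U) : DifferentiableAt ℝ F u :=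
  (hF.contDiffAt (hU.mem_nhds hu)).differentiableAt (by simp)

theorem pd_comm {V : Type*} [NormedAddCommGroup V] [NormedSpace ℝ V] {F : Plane → V}
    {U : Set Plane} (hU : IsOpen U) (hF : ContDiffOn ℝ ∞ F U) {u : Plane} (hu : u ∈ U)
    (i j : Fin 2) : pd i (pd j F) u = pd j (pd i F) u := by
  have hs : IsSymmSndFDerivAt ℝ F u :=
    (hF.contDiffAt (hU.mem_nhds hu)).isSymmSndFDerivAt (by
      simpa using WithTop.coe_le_coe.2 (le_top : (2 : ℕ∞) ≤ ⊤))
  have hd : DifferentiableAt ℝ (fderiv ℝ F) u :=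
    differentiableAt_of_contDiffOn hU (hF.fderiv_of_isOpen hU (by simp)) hu
  have key : ∀ k l : Fin 2, pd k (pd l F) u
      = fderiv ℝ (fderiv ℝ F) u (EuclideanSpace.single k 1) (EuclideanSpace.single l 1) := by
    intro k l
    have h := hd.hasFDerivAt.clm_apply (hasFDerivAt_const (EuclideanSpace.single l (1 : ℝ)) u)
    have h' : HasFDerivAt (pd l F) _ u := h
    simp only [pd] at h' ⊢
    rw [h'.fderiv]
    simp
  rw [key, key, hs.eq]

theorem plane_eq_sum (a : Plane) :
    a = ∑ k : Fin 2, a k • (EuclideanSpace.single k (1 : ℝ) : Plane) := by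
  ext i
  fin_cases i <;> simp

theorem fderiv_apply_eq_sum_pd {V : Type*} [NormedAddCommGroup V] [NormedSpace ℝ V]
    (F : Plane → V) (u a : Plane) : fderiv ℝ F u a = a 0 • pd 0 F u + a 1 • pd 1 F u := by
  conv_lhs => rw [plane_eq_sum a]
  simp [pd]

/-! ### Connection forms -/

/-- The connection form `θ_AB = -⟨dA, B⟩` of two vector fields along the surface; its value on `∂ᵢ`.
For null fields with `⟨A, B⟩ = -1` it is the coefficient of `A` in `dA`. -/
noncomputable def conn (A B : Plane → E52) (i : Fin 2) (u : Plane) : ℝ := -inner52 (pd i A u) (B u)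

/-- The value `θ(∂₀) η(∂₁) - θ(∂₁) η(∂₀)` of the exterior product of two `1`-forms. -/
def wedge (θ η : Fin 2 → Plane → ℝ) (u : Plane) : ℝ := θ 0 u * η 1 u - θ 1 u * η 0 u

/-- The value `∂₀ θ(∂₁) - ∂₁ θ(∂₀)` of the exterior derivative of a `1`-form. -/
noncomputable def extD (θ : Fin 2 → Plane → ℝ) (u : Plane) : ℝ := pd 0 (θ 1) u - pd 1 (θ 0) u

theorem contDiffOn_conn {A B : Plane → E52} {U : Set Plane} (hU : IsOpen U)
    (hA : ContDiffOn ℝ ∞ A U) (hB : ContDiffOn ℝ ∞ B U) (i : Fin 2) :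
    ContDiffOn ℝ ∞ (conn A B i) U :=
  (contDiffOn_inner52 (contDiffOn_pd hU hA i) hB).neg

theorem contDiffOn_wedge {θ η : Fin 2 → Plane → ℝ} {U : Set Plane}
    (hθ : ∀ i, ContDiffOn ℝ ∞ (θ i) U) (hη : ∀ i, ContDiffOn ℝ ∞ (η i) U) :
    ContDiffOn ℝ ∞ (wedge θ η) U :=
  ((hθ 0).mul (hη 1)).sub ((hθ 1).mul (hη 0))

theorem pd_conn {A B : Plane → E52} {U : Set Plane} (hU : IsOpen U)
    (hA : ContDiffOn ℝ ∞ A U) (hB : ContDiffOn ℝ ∞ B U) {u : Plane} (hu : u ∈ U) (i j : Fin 2) :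
    pd i (conn A B j) u = -inner52 (pd i (pd j A) u) (B u) - inner52 (pd j A u) (pd i B u) := by
  have h1 := differentiableAt_of_contDiffOn hU (contDiffOn_pd hU hA j) hu
  have h2 := differentiableAt_of_contDiffOn hU hB hu
  have : pd i (conn A B j) u = -pd i (fun w => inner52 (pd j A w) (B w)) u := pd_neg i
  rw [this, pd_inner52 i h1 h2]
  ring

/-- Cartan's structure equation: flatness of `𝔼⁵₂` expresses `dθ_AB` by first derivatives. -/
theorem extD_conn {A B : Plane → E52} {U : Set Plane} (hU : IsOpen U)
    (hA : ContDiffOn ℝ ∞ A U) (hB : ContDiffOn ℝ ∞ B U) {u : Plane} (hu : u ∈ U) :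
    extD (conn A B) u
      = inner52 (pd 0 A u) (pd 1 B u) - inner52 (pd 1 A u) (pd 0 B u) := by
  rw [extD, pd_conn hU hA hB hu, pd_conn hU hA hB hu, pd_comm hU hA hu 0 1]
  ring

theorem inner52_pd_swap {A B : Plane → E52} {U : Set Plane} (hU : IsOpen U)
    (hA : ContDiffOn ℝ ∞ A U) (hB : ContDiffOn ℝ ∞ B U) {c : ℝ}
    (hAB : ∀ w ∈ U, inner52 (A w) (B w) = c) {u : Plane} (hu : u ∈ U) (i : Fin 2) :
    inner52 (A u) (pd i B u) = -inner52 (pd i A u) (B u) := by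
  have h := pd_inner52 i (differentiableAt_of_contDiffOn hU hA hu)
    (differentiableAt_of_contDiffOn hU hB hu)
  have h0 : pd i (fun w => inner52 (A w) (B w)) u = 0 := by
    rw [pd_congr (G := fun _ => c) i (Filter.eventually_of_mem (hU.mem_nhds hu) hAB)]
    simp [pd]
  linarith

theorem conn_swap {A B : Plane → E52} {U : Set Plane} (hU : IsOpen U)
    (hA : ContDiffOn ℝ ∞ A U) (hB : ContDiffOn ℝ ∞ B U) {c : ℝ}
    (hAB : ∀ w ∈ U, inner52 (A w) (B w) = c) {u : Plane} (hu : u ∈ U) (i : Fin 2) :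
    conn B A i u = -conn A B i u := by
  rw [conn, conn, inner52_comm, inner52_pd_swap hU hA hB hAB hu]

/-! ### Null frames along the surface -/

/-- `E₁, E₂, F₃, F₄` is a pseudo-orthonormal null frame along the immersed surface `φ` in `𝕊⁴₂(1)`,
smooth on the open set `U`: the fields `E₁, E₂` are tangent (the plane of `∂₀φ, ∂₁φ` is orthogonal
to `φ, F₃, F₄`) and `F₃, F₄` are normal.  Non-vanishing of the exterior product of the coframe
`-⟨dφ, E₂⟩`, `-⟨dφ, E₁⟩` says that `φ` is an immersion. -/
structure IsNullFrame (φ E₁ E₂ F₃ F₄ : Plane → E52) (U : Set Plane) : Prop where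
  isOpen : IsOpen U
  smooth : ContDiffOn ℝ ∞ φ U
  smooth₁ : ContDiffOn ℝ ∞ E₁ U
  smooth₂ : ContDiffOn ℝ ∞ E₂ U
  smooth₃ : ContDiffOn ℝ ∞ F₃ U
  smooth₄ : ContDiffOn ℝ ∞ F₄ U
  inner_00 : ∀ u ∈ U, inner52 (φ u) (φ u) = 1
  inner_01 : ∀ u ∈ U, inner52 (φ u) (E₁ u) = 0
  inner_02 : ∀ u ∈ U, inner52 (φ u) (E₂ u) = 0
  inner_03 : ∀ u ∈ U, inner52 (φ u) (F₃ u) = 0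
  inner_04 : ∀ u ∈ U, inner52 (φ u) (F₄ u) = 0
  inner_11 : ∀ u ∈ U, inner52 (E₁ u) (E₁ u) = 0
  inner_12 : ∀ u ∈ U, inner52 (E₁ u) (E₂ u) = -1
  inner_22 : ∀ u ∈ U, inner52 (E₂ u) (E₂ u) = 0
  inner_13 : ∀ u ∈ U, inner52 (E₁ u) (F₃ u) = 0
  inner_14 : ∀ u ∈ U, inner52 (E₁ u) (F₄ u) = 0
  inner_23 : ∀ u ∈ U, inner52 (E₂ u) (F₃ u) = 0
  inner_24 : ∀ u ∈ U, inner52 (E₂ u) (F₄ u) = 0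
  inner_33 : ∀ u ∈ U, inner52 (F₃ u) (F₃ u) = 0
  inner_34 : ∀ u ∈ U, inner52 (F₃ u) (F₄ u) = -1
  inner_44 : ∀ u ∈ U, inner52 (F₄ u) (F₄ u) = 0
  normal₃ : ∀ u ∈ U, ∀ i, inner52 (pd i φ u) (F₃ u) = 0
  normal₄ : ∀ u ∈ U, ∀ i, inner52 (pd i φ u) (F₄ u) = 0
  coframe_ne : ∀ u ∈ U, wedge (conn φ E₂) (conn φ E₁) u ≠ 0

/-- The frame matrix has an explicit right inverse, because its Gram matrix is its own inverse. -/
theorem frameMatrix_mul {x e₁ e₂ f₃ f₄ : E52}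
    (h00 : inner52 x x = 1) (h01 : inner52 x e₁ = 0) (h02 : inner52 x e₂ = 0)
    (h03 : inner52 x f₃ = 0) (h04 : inner52 x f₄ = 0) (h11 : inner52 e₁ e₁ = 0)
    (h12 : inner52 e₁ e₂ = -1) (h22 : inner52 e₂ e₂ = 0) (h13 : inner52 e₁ f₃ = 0)
    (h14 : inner52 e₁ f₄ = 0) (h23 : inner52 e₂ f₃ = 0) (h24 : inner52 e₂ f₄ = 0)
    (h33 : inner52 f₃ f₃ = 0) (h34 : inner52 f₃ f₄ = -1) (h44 : inner52 f₄ f₄ = 0) :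
    (Matrix.of ![e₁, e₂, f₃, f₄, x] : Matrix (Fin 5) (Fin 5) ℝ) *
      (Matrix.diagonal ![-1, -1, 1, 1, 1] * (Matrix.of ![e₁, e₂, f₃, f₄, x]).transpose *
        !![0, -1, 0, 0, 0; -1, 0, 0, 0, 0; 0, 0, 0, -1, 0; 0, 0, -1, 0, 0; 0, 0, 0, 0, 1]) = 1 := by
  set A : Matrix (Fin 5) (Fin 5) ℝ := Matrix.of ![e₁, e₂, f₃, f₄, x]
  set η : Matrix (Fin 5) (Fin 5) ℝ := Matrix.diagonal ![-1, -1, 1, 1, 1] with hη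
  -- `C` is the Gram matrix of the frame, which is its own inverse
  set C : Matrix (Fin 5) (Fin 5) ℝ :=
    !![0, -1, 0, 0, 0; -1, 0, 0, 0, 0; 0, 0, 0, -1, 0; 0, 0, -1, 0, 0; 0, 0, 0, 0, 1] with hC
  have hip : ∀ v w : E52, ∑ j, v j * η.mulVec w j = inner52 v w := by
    intro v w
    simp only [hη, Matrix.mulVec_diagonal, Fin.sum_univ_five, inner52]
    simp
    ring
  have hgram : A * η * A.transpose = C := by
    have : ∀ i j, (A * η * A.transpose) i j
        = inner52 (![e₁, e₂, f₃, f₄, x] i) (![e₁, e₂, f₃, f₄, x] j) := by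
      intro i j
      rw [← hip, Matrix.mul_assoc, Matrix.mul_apply]
      rfl
    ext i j
    rw [this]
    have c1 := fun v w => inner52_comm v w
    fin_cases i <;> fin_cases j <;>
      simp [hC, h00, h01, h02, h03, h04, h11, h12, h22, h13, h14, h23, h24, h33, h34, h44,
        c1 e₁ x, c1 e₂ x, c1 f₃ x, c1 f₄ x, c1 e₂ e₁, c1 f₃ e₁, c1 f₄ e₁, c1 f₃ e₂, c1 f₄ e₂,
        c1 f₄ f₃]
  have hCC : C * C = 1 := by
    ext i j
    fin_cases i <;> fin_cases j <;> simp [hC, Matrix.mul_apply, Fin.sum_univ_five]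
  rw [← Matrix.mul_assoc, ← Matrix.mul_assoc, hgram, hCC]

/-- The expansion of a vector in a null frame. -/
theorem eq_expansion {x e₁ e₂ f₃ f₄ : E52}
    (h00 : inner52 x x = 1) (h01 : inner52 x e₁ = 0) (h02 : inner52 x e₂ = 0)
    (h03 : inner52 x f₃ = 0) (h04 : inner52 x f₄ = 0) (h11 : inner52 e₁ e₁ = 0)
    (h12 : inner52 e₁ e₂ = -1) (h22 : inner52 e₂ e₂ = 0) (h13 : inner52 e₁ f₃ = 0)
    (h14 : inner52 e₁ f₄ = 0) (h23 : inner52 e₂ f₃ = 0) (h24 : inner52 e₂ f₄ = 0)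
    (h33 : inner52 f₃ f₃ = 0) (h34 : inner52 f₃ f₄ = -1) (h44 : inner52 f₄ f₄ = 0) (v : E52) :
    v = inner52 v x • x - inner52 v e₂ • e₁ - inner52 v e₁ • e₂ - inner52 v f₄ • f₃
      - inner52 v f₃ • f₄ := by
  have hone := frameMatrix_mul h00 h01 h02 h03 h04 h11 h12 h22 h13 h14 h23 h24 h33 h34 h44
  set A : Matrix (Fin 5) (Fin 5) ℝ := Matrix.of ![e₁, e₂, f₃, f₄, x] with hA
  set η : Matrix (Fin 5) (Fin 5) ℝ := Matrix.diagonal ![-1, -1, 1, 1, 1] with hη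
  set C : Matrix (Fin 5) (Fin 5) ℝ :=
    !![0, -1, 0, 0, 0; -1, 0, 0, 0, 0; 0, 0, 0, -1, 0; 0, 0, -1, 0, 0; 0, 0, 0, 0, 1] with hC
  have hip : ∀ v w : E52, ∑ j, v j * η.mulVec w j = inner52 v w := by
    intro v w
    simp only [hη, Matrix.mulVec_diagonal, Fin.sum_univ_five, inner52]
    simp
    ring
  have hinv : A.transpose * C * A * η = 1 := by
    have h2 := congrArg Matrix.transpose hone
    have hC' : C.transpose = C := by
      ext i j
      fin_cases i <;> fin_cases j <;> simp [hC]
    have hη' : η.transpose = η := Matrix.diagonal_transpose _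
    rw [Matrix.transpose_mul, Matrix.transpose_mul, Matrix.transpose_mul, hC', hη',
      Matrix.transpose_transpose, Matrix.transpose_one] at h2
    have h3 := mul_eq_one_comm.1 h2
    simpa [Matrix.mul_assoc] using h3
  have hv : A.transpose.mulVec (C.mulVec (A.mulVec (η.mulVec v))) = v := by
    simp only [Matrix.mulVec_mulVec]
    rw [← Matrix.mul_assoc, ← Matrix.mul_assoc, hinv, Matrix.one_mulVec]
  have hAv : ∀ i, A.mulVec (η.mulVec v) i = inner52 v (![e₁, e₂, f₃, f₄, x] i) := by
    intro i
    rw [inner52_comm, ← hip]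
    rfl
  conv_lhs => rw [← hv]
  ext k
  have e5 : ∀ (B : Matrix (Fin 5) (Fin 5) ℝ) (z : E52) i, B.mulVec z i = ∑ j, B i j * z j :=
    fun _ _ _ => rfl
  rw [e5]
  simp only [e5 C, hAv, Fin.sum_univ_five, Matrix.transpose_apply]
  simp [hA, hC]
  ring

namespace IsNullFrame

variable {φ E₁ E₂ F₃ F₄ : Plane → E52} {U : Set Plane}

theorem expansion (h : IsNullFrame φ E₁ E₂ F₃ F₄ U) {u : Plane} (hu : u ∈ U) (v : E52) :
    v = inner52 v (φ u) • φ u - inner52 v (E₂ u) • E₁ u - inner52 v (E₁ u) • E₂ u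
      - inner52 v (F₄ u) • F₃ u - inner52 v (F₃ u) • F₄ u :=
  eq_expansion (h.inner_00 u hu) (h.inner_01 u hu) (h.inner_02 u hu) (h.inner_03 u hu)
    (h.inner_04 u hu) (h.inner_11 u hu) (h.inner_12 u hu) (h.inner_22 u hu) (h.inner_13 u hu)
    (h.inner_14 u hu) (h.inner_23 u hu) (h.inner_24 u hu) (h.inner_33 u hu) (h.inner_34 u hu)
    (h.inner_44 u hu) v

theorem parseval (h : IsNullFrame φ E₁ E₂ F₃ F₄ U) {u : Plane} (hu : u ∈ U) (v w : E52) :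
    inner52 v w = inner52 v (φ u) * inner52 w (φ u) - inner52 v (E₂ u) * inner52 w (E₁ u)
      - inner52 v (E₁ u) * inner52 w (E₂ u) - inner52 v (F₄ u) * inner52 w (F₃ u)
      - inner52 v (F₃ u) * inner52 w (F₄ u) := by
  conv_lhs => rw [h.expansion hu v]
  simp only [inner52_sub_left, inner52_smul_left]
  rw [inner52_comm (φ u) w, inner52_comm (E₁ u) w, inner52_comm (E₂ u) w, inner52_comm (F₃ u) w,
    inner52_comm (F₄ u) w]

/-- Exchanging `F₃` and `F₄` gives a null frame, of the opposite orientation. -/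
theorem swap (h : IsNullFrame φ E₁ E₂ F₃ F₄ U) : IsNullFrame φ E₁ E₂ F₄ F₃ U where
  isOpen := h.isOpen
  smooth := h.smooth
  smooth₁ := h.smooth₁
  smooth₂ := h.smooth₂
  smooth₃ := h.smooth₄
  smooth₄ := h.smooth₃
  inner_00 := h.inner_00
  inner_01 := h.inner_01
  inner_02 := h.inner_02
  inner_03 := h.inner_04
  inner_04 := h.inner_03
  inner_11 := h.inner_11
  inner_12 := h.inner_12
  inner_22 := h.inner_22
  inner_13 := h.inner_14
  inner_14 := h.inner_13
  inner_23 := h.inner_24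
  inner_24 := h.inner_23
  inner_33 := h.inner_44
  inner_34 := fun u hu => by rw [inner52_comm]; exact h.inner_34 u hu
  inner_44 := h.inner_33
  normal₃ := h.normal₄
  normal₄ := h.normal₃
  coframe_ne := h.coframe_ne

/-- Exchanging `E₁` and `E₂` gives a null frame, of the opposite orientation. -/
theorem swapTangent (h : IsNullFrame φ E₁ E₂ F₃ F₄ U) : IsNullFrame φ E₂ E₁ F₃ F₄ U where
  isOpen := h.isOpen
  smooth := h.smooth
  smooth₁ := h.smooth₂
  smooth₂ := h.smooth₁
  smooth₃ := h.smooth₃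
  smooth₄ := h.smooth₄
  inner_00 := h.inner_00
  inner_01 := h.inner_02
  inner_02 := h.inner_01
  inner_03 := h.inner_03
  inner_04 := h.inner_04
  inner_11 := h.inner_22
  inner_12 := fun u hu => by rw [inner52_comm]; exact h.inner_12 u hu
  inner_22 := h.inner_11
  inner_13 := h.inner_23
  inner_14 := h.inner_24
  inner_23 := h.inner_13
  inner_24 := h.inner_14
  inner_33 := h.inner_33
  inner_34 := h.inner_34
  inner_44 := h.inner_44
  normal₃ := h.normal₃
  normal₄ := h.normal₄
  coframe_ne := fun u hu h0 => h.coframe_ne u hu (by rw [wedge] at h0 ⊢; linarith)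

/-! ### Structure equations -/

theorem conn_self_pos (h : IsNullFrame φ E₁ E₂ F₃ F₄ U) {u : Plane} (hu : u ∈ U) (i : Fin 2) :
    conn φ φ i u = 0 := by
  linarith [conn_swap h.isOpen h.smooth h.smooth h.inner_00 hu i]

theorem conn_11 (h : IsNullFrame φ E₁ E₂ F₃ F₄ U) {u : Plane} (hu : u ∈ U) (i : Fin 2) :
    conn E₁ E₁ i u = 0 := by
  linarith [conn_swap h.isOpen h.smooth₁ h.smooth₁ h.inner_11 hu i]

theorem conn_22 (h : IsNullFrame φ E₁ E₂ F₃ F₄ U) {u : Plane} (hu : u ∈ U) (i : Fin 2) :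
    conn E₂ E₂ i u = 0 := h.swapTangent.conn_11 hu i

theorem conn_33 (h : IsNullFrame φ E₁ E₂ F₃ F₄ U) {u : Plane} (hu : u ∈ U) (i : Fin 2) :
    conn F₃ F₃ i u = 0 := by
  linarith [conn_swap h.isOpen h.smooth₃ h.smooth₃ h.inner_33 hu i]

theorem conn_44 (h : IsNullFrame φ E₁ E₂ F₃ F₄ U) {u : Plane} (hu : u ∈ U) (i : Fin 2) :
    conn F₄ F₄ i u = 0 := h.swap.conn_33 hu i

theorem conn_03 (h : IsNullFrame φ E₁ E₂ F₃ F₄ U) {u : Plane} (hu : u ∈ U) (i : Fin 2) :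
    conn φ F₃ i u = 0 := by
  rw [conn, h.normal₃ u hu i, neg_zero]

theorem conn_04 (h : IsNullFrame φ E₁ E₂ F₃ F₄ U) {u : Plane} (hu : u ∈ U) (i : Fin 2) :
    conn φ F₄ i u = 0 := h.swap.conn_03 hu i

theorem conn_30 (h : IsNullFrame φ E₁ E₂ F₃ F₄ U) {u : Plane} (hu : u ∈ U) (i : Fin 2) :
    conn F₃ φ i u = 0 := by
  rw [conn_swap h.isOpen h.smooth h.smooth₃ h.inner_03 hu, h.conn_03 hu, neg_zero]

theorem conn_40 (h : IsNullFrame φ E₁ E₂ F₃ F₄ U) {u : Plane} (hu : u ∈ U) (i : Fin 2) :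
    conn F₄ φ i u = 0 := h.swap.conn_30 hu i

theorem conn_10 (h : IsNullFrame φ E₁ E₂ F₃ F₄ U) {u : Plane} (hu : u ∈ U) (i : Fin 2) :
    conn E₁ φ i u = -conn φ E₁ i u :=
  conn_swap h.isOpen h.smooth h.smooth₁ h.inner_01 hu i

theorem conn_20 (h : IsNullFrame φ E₁ E₂ F₃ F₄ U) {u : Plane} (hu : u ∈ U) (i : Fin 2) :
    conn E₂ φ i u = -conn φ E₂ i u := h.swapTangent.conn_10 hu i

theorem conn_21 (h : IsNullFrame φ E₁ E₂ F₃ F₄ U) {u : Plane} (hu : u ∈ U) (i : Fin 2) :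
    conn E₂ E₁ i u = -conn E₁ E₂ i u :=
  conn_swap h.isOpen h.smooth₁ h.smooth₂ h.inner_12 hu i

theorem conn_43 (h : IsNullFrame φ E₁ E₂ F₃ F₄ U) {u : Plane} (hu : u ∈ U) (i : Fin 2) :
    conn F₄ F₃ i u = -conn F₃ F₄ i u :=
  conn_swap h.isOpen h.smooth₃ h.smooth₄ h.inner_34 hu i

theorem conn_31 (h : IsNullFrame φ E₁ E₂ F₃ F₄ U) {u : Plane} (hu : u ∈ U) (i : Fin 2) :
    conn F₃ E₁ i u = -conn E₁ F₃ i u :=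
  conn_swap h.isOpen h.smooth₁ h.smooth₃ h.inner_13 hu i

theorem conn_32 (h : IsNullFrame φ E₁ E₂ F₃ F₄ U) {u : Plane} (hu : u ∈ U) (i : Fin 2) :
    conn F₃ E₂ i u = -conn E₂ F₃ i u := h.swapTangent.conn_31 hu i

theorem conn_41 (h : IsNullFrame φ E₁ E₂ F₃ F₄ U) {u : Plane} (hu : u ∈ U) (i : Fin 2) :
    conn F₄ E₁ i u = -conn E₁ F₄ i u := h.swap.conn_31 hu i

theorem conn_42 (h : IsNullFrame φ E₁ E₂ F₃ F₄ U) {u : Plane} (hu : u ∈ U) (i : Fin 2) :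
    conn F₄ E₂ i u = -conn E₂ F₄ i u := h.swap.conn_32 hu i

/-- Cartan's structure equations of the null frame. -/
theorem extD_conn_eq (h : IsNullFrame φ E₁ E₂ F₃ F₄ U) {A B : Plane → E52}
    (hA : ContDiffOn ℝ ∞ A U) (hB : ContDiffOn ℝ ∞ B U) {u : Plane} (hu : u ∈ U) :
    extD (conn A B) u = wedge (conn A φ) (conn B φ) u - wedge (conn A E₂) (conn B E₁) u
      - wedge (conn A E₁) (conn B E₂) u - wedge (conn A F₄) (conn B F₃) u
      - wedge (conn A F₃) (conn B F₄) u := by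
  rw [extD_conn h.isOpen hA hB hu, h.parseval hu (pd 0 A u), h.parseval hu (pd 1 A u)]
  simp only [wedge, conn]
  ring

theorem extD_coframe₁ (h : IsNullFrame φ E₁ E₂ F₃ F₄ U) {u : Plane} (hu : u ∈ U) :
    extD (conn φ E₂) u = wedge (conn φ E₂) (conn E₁ E₂) u := by
  rw [h.extD_conn_eq h.smooth h.smooth₂ hu]
  simp only [wedge, h.conn_self_pos hu, h.conn_21 hu, h.conn_22 hu, h.conn_03 hu, h.conn_04 hu]
  ring

theorem pd_coframe₁_comm (h : IsNullFrame φ E₁ E₂ F₃ F₄ U) {u : Plane} (hu : u ∈ U)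
    (i j : Fin 2) :
    pd i (conn φ E₂ j) u + conn φ E₂ j u * conn E₁ E₂ i u
      = pd j (conn φ E₂ i) u + conn φ E₂ i u * conn E₁ E₂ j u := by
  have h1 := h.extD_coframe₁ hu
  simp only [extD, wedge] at h1
  fin_cases i <;> fin_cases j <;> simp <;> linarith

theorem pd_coframe₂_comm (h : IsNullFrame φ E₁ E₂ F₃ F₄ U) {u : Plane} (hu : u ∈ U)
    (i j : Fin 2) :
    pd i (conn φ E₁ j) u - conn φ E₁ j u * conn E₁ E₂ i u
      = pd j (conn φ E₁ i) u - conn φ E₁ i u * conn E₁ E₂ j u := by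
  have h1 := h.swapTangent.pd_coframe₁_comm hu i j
  simp only [h.conn_21 hu] at h1
  linarith

theorem gram_eq (h : IsNullFrame φ E₁ E₂ F₃ F₄ U) {u : Plane} (hu : u ∈ U) (i j : Fin 2) :
    gram φ u i j = -(conn φ E₂ i u * conn φ E₁ j u + conn φ E₁ i u * conn φ E₂ j u) := by
  have h1 := h.parseval hu (pd i φ u) (pd j φ u)
  have h2 := h.conn_self_pos hu i
  have h3 := h.normal₃ u hu i
  have h4 := h.normal₄ u hu i
  simp only [conn, gram, Matrix.of_apply] at *
  rw [h1, h3, h4, neg_eq_zero.1 h2]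
  ring

/-- In terms of a null frame, `dφ` is `p E₁ + q E₂`, with `p = -⟨dφ, E₂⟩` and `q = -⟨dφ, E₁⟩`. -/
theorem pd_position (h : IsNullFrame φ E₁ E₂ F₃ F₄ U) {u : Plane} (hu : u ∈ U) (i : Fin 2) :
    pd i φ u = conn φ E₂ i u • E₁ u + conn φ E₁ i u • E₂ u := by
  have h2 := h.conn_self_pos hu i
  rw [conn, neg_eq_zero] at h2
  conv_lhs => rw [h.expansion hu (pd i φ u), h.normal₃ u hu i, h.normal₄ u hu i, h2]
  simp only [conn]
  module

end IsNullFrame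

/-! ### Codazzi, Gauss and Ricci equations of minimal surfaces -/

/-- The coefficient `-⟨h(E, E), F⟩` of the second fundamental form, for a null tangent frame
`E, E'`. -/
noncomputable def shape (φ E E' F : Plane → E52) (u : Plane) : ℝ :=
  wedge (conn E F) (conn φ E) u / wedge (conn φ E') (conn φ E) u

/-- The equation `h(E₁, E₂) = 0` of a minimal surface, tested against `F`: the forms `⟨dE₁, F⟩` and
`⟨dE₂, F⟩` are multiples of `⟨dφ, E₂⟩` and of `⟨dφ, E₁⟩`,
respectively. -/
def MixedVanishes (φ E₁ E₂ F : Plane → E52) (u : Plane) : Prop :=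
  wedge (conn E₁ F) (conn φ E₂) u = 0 ∧ wedge (conn E₂ F) (conn φ E₁) u = 0

namespace IsNullFrame

variable {φ E₁ E₂ F₃ F₄ : Plane → E52} {U : Set Plane}

theorem conn_eq_shape (h : IsNullFrame φ E₁ E₂ F₃ F₄ U) {F : Plane → E52} {u : Plane}
    (hu : u ∈ U) (hm : MixedVanishes φ E₁ E₂ F u) (i : Fin 2) :
    conn E₁ F i u = shape φ E₁ E₂ F u * conn φ E₂ i u := by
  have hJ := h.coframe_ne u hu
  have h1 := hm.1
  rw [shape, div_mul_eq_mul_div, eq_div_iff hJ]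
  simp only [wedge] at *
  fin_cases i <;> simp
  · linear_combination (-conn φ E₁ 0 u) * h1
  · linear_combination (-conn φ E₁ 1 u) * h1

theorem conn_eq_shape' (h : IsNullFrame φ E₁ E₂ F₃ F₄ U) {F : Plane → E52} {u : Plane}
    (hu : u ∈ U) (hm : MixedVanishes φ E₁ E₂ F u) (i : Fin 2) :
    conn E₂ F i u = shape φ E₂ E₁ F u * conn φ E₁ i u :=
  h.swapTangent.conn_eq_shape hu ⟨hm.2, hm.1⟩ i

theorem contDiffOn_shape (h : IsNullFrame φ E₁ E₂ F₃ F₄ U) {F : Plane → E52}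
    (hF : ContDiffOn ℝ ∞ F U) : ContDiffOn ℝ ∞ (shape φ E₁ E₂ F) U :=
  (contDiffOn_wedge (contDiffOn_conn h.isOpen h.smooth₁ hF)
    (contDiffOn_conn h.isOpen h.smooth h.smooth₁)).div
    (contDiffOn_wedge (contDiffOn_conn h.isOpen h.smooth h.smooth₂)
      (contDiffOn_conn h.isOpen h.smooth h.smooth₁)) h.coframe_ne

/-- The Codazzi equation for the coefficient `a = -⟨h(E₁, E₁), F₄⟩`: the form `da - 2 a α + a β` is a
multiple of `p = -⟨dφ, E₂⟩`. -/
theorem codazzi (h : IsNullFrame φ E₁ E₂ F₃ F₄ U)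
    (hm₃ : ∀ u ∈ U, MixedVanishes φ E₁ E₂ F₃ u) (hm₄ : ∀ u ∈ U, MixedVanishes φ E₁ E₂ F₄ u)
    {u : Plane} (hu : u ∈ U) :
    (pd 0 (shape φ E₁ E₂ F₄) u
        + shape φ E₁ E₂ F₄ u * (conn F₃ F₄ 0 u - 2 * conn E₁ E₂ 0 u)) * conn φ E₂ 1 u
      = (pd 1 (shape φ E₁ E₂ F₄) u
        + shape φ E₁ E₂ F₄ u * (conn F₃ F₄ 1 u - 2 * conn E₁ E₂ 1 u)) * conn φ E₂ 0 u := by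
  have ha := differentiableAt_of_contDiffOn h.isOpen (h.contDiffOn_shape h.smooth₄) hu
  have hp := fun i => differentiableAt_of_contDiffOn h.isOpen
    (contDiffOn_conn h.isOpen h.smooth h.smooth₂ i) hu
  have hd : ∀ i j, pd i (conn E₁ F₄ j) u = shape φ E₁ E₂ F₄ u * pd i (conn φ E₂ j) u
      + pd i (shape φ E₁ E₂ F₄) u * conn φ E₂ j u := by
    intro i j
    rw [← pd_mul i ha (hp j)]
    exact pd_congr i (Filter.eventually_of_mem (h.isOpen.mem_nhds hu)
      fun w hw => h.conn_eq_shape hw (hm₄ w hw) j)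
  have h1 := h.extD_conn_eq h.smooth₁ h.smooth₄ hu
  have h2 := h.extD_coframe₁ hu
  simp only [extD, wedge, hd, h.conn_10 hu, h.conn_40 hu, h.conn_41 hu, h.conn_42 hu, h.conn_11 hu,
    h.conn_43 hu, h.conn_44 hu, h.conn_eq_shape hu (hm₄ u hu), h.conn_eq_shape hu (hm₃ u hu),
    h.conn_eq_shape' hu (hm₄ u hu)] at h1 h2
  linear_combination h1 - shape φ E₁ E₂ F₄ u * h2

/-- If the product of `a = -⟨h(E₁, E₁), F₄⟩` and `d = -⟨h(E₂, E₂), F₃⟩` is a nonzero constant, both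
Codazzi equations together give `da = a (2 α - β)`, so that `dβ = 2 dα`. -/
theorem extD_normal_eq_two_mul (h : IsNullFrame φ E₁ E₂ F₃ F₄ U)
    (hm₃ : ∀ u ∈ U, MixedVanishes φ E₁ E₂ F₃ u) (hm₄ : ∀ u ∈ U, MixedVanishes φ E₁ E₂ F₄ u)
    {m : ℝ} (hm : m ≠ 0) (had : ∀ u ∈ U, shape φ E₁ E₂ F₄ u * shape φ E₂ E₁ F₃ u = m)
    {u : Plane} (hu : u ∈ U) : extD (conn F₃ F₄) u = 2 * extD (conn E₁ E₂) u := by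
  have hda : ∀ w ∈ U, ∀ i, pd i (shape φ E₁ E₂ F₄) w
      = shape φ E₁ E₂ F₄ w * (2 * conn E₁ E₂ i w - conn F₃ F₄ i w) := by
    intro w hw
    have c1 := h.codazzi hm₃ hm₄ hw
    have c2 := h.swap.swapTangent.codazzi (fun v hv => ⟨(hm₄ v hv).2, (hm₄ v hv).1⟩)
      (fun v hv => ⟨(hm₃ v hv).2, (hm₃ v hv).1⟩) hw
    simp only [h.conn_43 hw, h.conn_21 hw] at c2
    have hsum : ∀ i, shape φ E₁ E₂ F₄ w * pd i (shape φ E₂ E₁ F₃) w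
        + pd i (shape φ E₁ E₂ F₄) w * shape φ E₂ E₁ F₃ w = 0 := by
      intro i
      rw [← pd_mul i
        (differentiableAt_of_contDiffOn h.isOpen (h.contDiffOn_shape h.smooth₄) hw)
        (differentiableAt_of_contDiffOn h.isOpen
          (h.swapTangent.contDiffOn_shape h.smooth₃) hw),
        pd_congr (G := fun _ => m) i (Filter.eventually_of_mem (h.isOpen.mem_nhds hw) had)]
      simp [pd]
    have hd0 : shape φ E₂ E₁ F₃ w ≠ 0 := by
      intro h0
      exact hm (by rw [← had w hw, h0, mul_zero])
    have hJ := h.coframe_ne w hw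
    generalize shape φ E₁ E₂ F₄ w = a at *
    generalize shape φ E₂ E₁ F₃ w = d at *
    have s0 := hsum 0
    have s1 := hsum 1
    simp only [wedge] at hJ
    -- as `a dd = -d da`, the Codazzi form of `d`, multiplied by `a`, is that of `a`, multiplied by
    -- `-d`; so the latter is a multiple of both coframe forms, and vanishes
    have c3 : (pd 0 (shape φ E₁ E₂ F₄) w + a * (conn F₃ F₄ 0 w - 2 * conn E₁ E₂ 0 w))
          * conn φ E₁ 1 w
        = (pd 1 (shape φ E₁ E₂ F₄) w + a * (conn F₃ F₄ 1 w - 2 * conn E₁ E₂ 1 w))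
          * conn φ E₁ 0 w := by
      apply mul_left_cancel₀ hd0
      linear_combination (-a) * c2 + conn φ E₁ 1 w * s0 - conn φ E₁ 0 w * s1
    have z0 : pd 0 (shape φ E₁ E₂ F₄) w + a * (conn F₃ F₄ 0 w - 2 * conn E₁ E₂ 0 w) = 0 := by
      apply mul_left_cancel₀ hJ
      linear_combination conn φ E₂ 0 w * c3 - conn φ E₁ 0 w * c1
    have z1 : pd 1 (shape φ E₁ E₂ F₄) w + a * (conn F₃ F₄ 1 w - 2 * conn E₁ E₂ 1 w) = 0 := by
      apply mul_left_cancel₀ hJ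
      linear_combination conn φ E₂ 1 w * c3 - conn φ E₁ 1 w * c1
    intro i
    fin_cases i <;> simp <;> linarith
  have ha0 : shape φ E₁ E₂ F₄ u ≠ 0 := by
    intro h0
    exact hm (by rw [← had u hu, h0, zero_mul])
  have hsm := h.contDiffOn_shape h.smooth₄
  have hα := contDiffOn_conn h.isOpen h.smooth₁ h.smooth₂
  have hβ := contDiffOn_conn h.isOpen h.smooth₃ h.smooth₄
  have hdd : ∀ i j, pd i (pd j (shape φ E₁ E₂ F₄)) u
      = shape φ E₁ E₂ F₄ u * (2 * pd i (conn E₁ E₂ j) u - pd i (conn F₃ F₄ j) u)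
        + pd i (shape φ E₁ E₂ F₄) u * (2 * conn E₁ E₂ j u - conn F₃ F₄ j u) := by
    intro i j
    have hα' := differentiableAt_of_contDiffOn h.isOpen (hα j) hu
    have hβ' := differentiableAt_of_contDiffOn h.isOpen (hβ j) hu
    have e : pd i (fun w => 2 * conn E₁ E₂ j w - conn F₃ F₄ j w) u
        = 2 * pd i (conn E₁ E₂ j) u - pd i (conn F₃ F₄ j) u := by
      simp only [pd]
      rw [fderiv_fun_sub (hα'.const_mul 2) hβ', fderiv_const_mul hα']
      simp
    rw [← e, ← pd_mul (s := fun w => 2 * conn E₁ E₂ j w - conn F₃ F₄ j w) i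
      (differentiableAt_of_contDiffOn h.isOpen hsm hu) ((hα'.const_mul 2).sub hβ')]
    exact pd_congr i (Filter.eventually_of_mem (h.isOpen.mem_nhds hu) fun w hw => hda w hw j)
  have hs := pd_comm h.isOpen hsm hu 0 1
  rw [hdd, hdd, hda u hu, hda u hu] at hs
  rw [extD, extD]
  apply mul_left_cancel₀ ha0
  linear_combination -hs

theorem extD_tangent (h : IsNullFrame φ E₁ E₂ F₃ F₄ U) {u : Plane} (hu : u ∈ U)
    (hm₃ : MixedVanishes φ E₁ E₂ F₃ u) (hm₄ : MixedVanishes φ E₁ E₂ F₄ u) :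
    extD (conn E₁ E₂) u = -(1 + shape φ E₁ E₂ F₄ u * shape φ E₂ E₁ F₃ u
      + shape φ E₁ E₂ F₃ u * shape φ E₂ E₁ F₄ u) * wedge (conn φ E₂) (conn φ E₁) u := by
  rw [h.extD_conn_eq h.smooth₁ h.smooth₂ hu]
  simp only [wedge, h.conn_10 hu, h.conn_20 hu, h.conn_11 hu, h.conn_22 hu, h.conn_21 hu,
    h.conn_eq_shape hu hm₄, h.conn_eq_shape hu hm₃, h.conn_eq_shape' hu hm₄,
    h.conn_eq_shape' hu hm₃]
  ring

theorem extD_normal (h : IsNullFrame φ E₁ E₂ F₃ F₄ U) {u : Plane} (hu : u ∈ U)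
    (hm₃ : MixedVanishes φ E₁ E₂ F₃ u) (hm₄ : MixedVanishes φ E₁ E₂ F₄ u) :
    extD (conn F₃ F₄) u = (shape φ E₁ E₂ F₄ u * shape φ E₂ E₁ F₃ u
      - shape φ E₁ E₂ F₃ u * shape φ E₂ E₁ F₄ u) * wedge (conn φ E₂) (conn φ E₁) u := by
  rw [h.extD_conn_eq h.smooth₃ h.smooth₄ hu]
  simp only [wedge, h.conn_30 hu, h.conn_40 hu, h.conn_33 hu, h.conn_44 hu, h.conn_43 hu,
    h.conn_31 hu, h.conn_32 hu, h.conn_41 hu, h.conn_42 hu,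
    h.conn_eq_shape hu hm₄, h.conn_eq_shape hu hm₃, h.conn_eq_shape' hu hm₄,
    h.conn_eq_shape' hu hm₃]
  ring

/-- If `K = 1 + a d + b c` and `K^D = a d - b c` are constant, then `a d` and `b c` are; whichever of
the two does not vanish forces `K^D = -2 K`, respectively `K^D = 2 K`. -/
theorem curvatures_eq (h : IsNullFrame φ E₁ E₂ F₃ F₄ U)
    (hm₃ : ∀ u ∈ U, MixedVanishes φ E₁ E₂ F₃ u) (hm₄ : ∀ u ∈ U, MixedVanishes φ E₁ E₂ F₄ u)
    {K KD : ℝ}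
    (hK : ∀ u ∈ U, 1 + shape φ E₁ E₂ F₄ u * shape φ E₂ E₁ F₃ u
      + shape φ E₁ E₂ F₃ u * shape φ E₂ E₁ F₄ u = K)
    (hKD : ∀ u ∈ U, shape φ E₁ E₂ F₄ u * shape φ E₂ E₁ F₃ u
      - shape φ E₁ E₂ F₃ u * shape φ E₂ E₁ F₄ u = KD)
    (hKD0 : KD ≠ 0) {u : Plane} (hu : u ∈ U) : K = 1 / 3 ∧ |KD| = 2 / 3 := by
  have hJ := h.coframe_ne u hu
  have eα := h.extD_tangent hu (hm₃ u hu) (hm₄ u hu)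
  have eβ := h.extD_normal hu (hm₃ u hu) (hm₄ u hu)
  rw [hK u hu] at eα
  rw [hKD u hu] at eβ
  have hc1 : (K - 1 + KD) / 2 ≠ 0 → KD = -2 * K := by
    intro hne
    have e := h.extD_normal_eq_two_mul hm₃ hm₄ hne
      (fun w hw => by linarith [hK w hw, hKD w hw]) hu
    apply mul_right_cancel₀ hJ
    rw [← eβ, e, eα]
    ring
  have hc2 : (K - 1 - KD) / 2 ≠ 0 → KD = 2 * K := by
    intro hne
    have e := h.swap.extD_normal_eq_two_mul hm₄ hm₃ hne
      (fun w hw => by linarith [hK w hw, hKD w hw]) hu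
    have eβ' := h.swap.extD_normal hu (hm₄ u hu) (hm₃ u hu)
    have e4 : shape φ E₁ E₂ F₃ u * shape φ E₂ E₁ F₄ u
      - shape φ E₁ E₂ F₄ u * shape φ E₂ E₁ F₃ u = -KD := by linarith [hKD u hu]
    rw [e4] at eβ'
    apply mul_right_cancel₀ hJ
    linear_combination eβ' - e - 2 * eα
  by_cases h1 : (K - 1 + KD) / 2 = 0
  · have h2 : KD = 2 * K := hc2 fun h2 => hKD0 (by linarith)
    have h3 : K = 1 / 3 := by linarith
    exact ⟨h3, by rw [h2, h3]; norm_num⟩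
  · have h2 := hc1 h1
    by_cases h3 : (K - 1 - KD) / 2 = 0
    · have h4 : K = 1 / 3 := by linarith
      exact ⟨h4, by rw [h2, h4]; norm_num⟩
    · exact absurd (hc2 h3) fun h4 => hKD0 (by linarith)

end IsNullFrame

/-! ### Gaussian curvature and mean curvature in terms of a null frame -/

/-- The components `(q₁, -q₀) / (p₀ q₁ - p₁ q₀)` of the vector on which the form `p` is `1` and the
form `q` is `0`. -/
noncomputable def dualVec (p q : Fin 2 → Plane → ℝ) (k : Fin 2) (u : Plane) : ℝ :=
  ![q 1 u, -q 0 u] k / wedge p q u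

namespace IsNullFrame

variable {φ E₁ E₂ F₃ F₄ : Plane → E52} {U : Set Plane}

theorem gram_inv_eq (h : IsNullFrame φ E₁ E₂ F₃ F₄ U) {u : Plane} (hu : u ∈ U) (i j : Fin 2) :
    (gram φ u)⁻¹ i j
      = -(dualVec (conn φ E₂) (conn φ E₁) i u * dualVec (conn φ E₁) (conn φ E₂) j u
        + dualVec (conn φ E₁) (conn φ E₂) i u * dualVec (conn φ E₂) (conn φ E₁) j u) := by
  have hJ := h.coframe_ne u hu
  have key : gram φ u * Matrix.of (fun i j =>
      -(dualVec (conn φ E₂) (conn φ E₁) i u * dualVec (conn φ E₁) (conn φ E₂) j u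
        + dualVec (conn φ E₁) (conn φ E₂) i u * dualVec (conn φ E₂) (conn φ E₁) j u)) = 1 := by
    ext k l
    have hs : wedge (conn φ E₁) (conn φ E₂) u = -wedge (conn φ E₂) (conn φ E₁) u := by
      simp only [wedge]
      ring
    simp only [Matrix.mul_apply, Fin.sum_univ_two, h.gram_eq hu, Matrix.of_apply, dualVec, hs]
    have hJJ : wedge (conn φ E₂) (conn φ E₁) u
      = conn φ E₂ 0 u * conn φ E₁ 1 u - conn φ E₂ 1 u * conn φ E₁ 0 u := rfl
    generalize wedge (conn φ E₂) (conn φ E₁) u = J at *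
    fin_cases k <;> fin_cases l <;> simp <;> field_simp <;> (try rw [hJJ]) <;> ring
  rw [Matrix.inv_eq_right_inv key, Matrix.of_apply]

theorem contDiffOn_dualVec (h : IsNullFrame φ E₁ E₂ F₃ F₄ U) (k : Fin 2) :
    ContDiffOn ℝ ∞ (dualVec (conn φ E₂) (conn φ E₁) k) U := by
  have hq := contDiffOn_conn h.isOpen h.smooth h.smooth₁
  have hp := contDiffOn_conn h.isOpen h.smooth h.smooth₂
  refine ContDiffOn.div ?_ (contDiffOn_wedge hp hq) h.coframe_ne
  fin_cases k
  · exact hq 1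
  · exact (hq 0).neg

theorem coframe_dualVec (h : IsNullFrame φ E₁ E₂ F₃ F₄ U) {u : Plane} (hu : u ∈ U) :
    ∑ k, conn φ E₂ k u * dualVec (conn φ E₂) (conn φ E₁) k u = 1 := by
  have hJ := h.coframe_ne u hu
  simp only [dualVec, Fin.sum_univ_two]
  simp only [wedge] at *
  simp
  field_simp
  ring

theorem coframe_dualVec' (h : IsNullFrame φ E₁ E₂ F₃ F₄ U) {u : Plane} (hu : u ∈ U) :
    ∑ k, conn φ E₂ k u * dualVec (conn φ E₁) (conn φ E₂) k u = 0 := by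
  have hJ := h.swapTangent.coframe_ne u hu
  simp only [dualVec, Fin.sum_univ_two]
  simp only [wedge] at *
  simp
  field_simp
  ring

theorem pd_gram (h : IsNullFrame φ E₁ E₂ F₃ F₄ U) {u : Plane} (hu : u ∈ U) (i j l : Fin 2) :
    pd i (fun w => gram φ w j l) u
      = -(conn φ E₂ j u * pd i (conn φ E₁ l) u + pd i (conn φ E₂ j) u * conn φ E₁ l u
        + (conn φ E₁ j u * pd i (conn φ E₂ l) u + pd i (conn φ E₁ j) u * conn φ E₂ l u)) := by
  have hq := fun k => differentiableAt_of_contDiffOn h.isOpen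
    (contDiffOn_conn h.isOpen h.smooth h.smooth₁ k) hu
  have hp := fun k => differentiableAt_of_contDiffOn h.isOpen
    (contDiffOn_conn h.isOpen h.smooth h.smooth₂ k) hu
  rw [← pd_mul i (hp j) (hq l), ← pd_mul i (hq j) (hp l),
    ← pd_add i ((hp j).fun_mul (hq l)) ((hq j).fun_mul (hp l)), ← pd_neg]
  exact pd_congr i (Filter.eventually_of_mem (h.isOpen.mem_nhds hu)
    fun w hw => h.gram_eq hw j l)

/-- The Levi-Civita connection has the connection form `α = -⟨dE₁, E₂⟩` in a null frame. -/
theorem christoffel_eq (h : IsNullFrame φ E₁ E₂ F₃ F₄ U) {u : Plane} (hu : u ∈ U)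
    (k i j : Fin 2) :
    christoffel φ k i j u
      = dualVec (conn φ E₂) (conn φ E₁) k u
          * (pd i (conn φ E₂ j) u + conn φ E₂ j u * conn E₁ E₂ i u)
        + dualVec (conn φ E₁) (conn φ E₂) k u
          * (pd i (conn φ E₁ j) u - conn φ E₁ j u * conn E₁ E₂ i u) := by
  have hsum : ∀ l, pd i (fun w => gram φ w j l) u + pd j (fun w => gram φ w i l) u
      - pd l (fun w => gram φ w i j) u
      = -2 * ((pd i (conn φ E₂ j) u + conn φ E₂ j u * conn E₁ E₂ i u) * conn φ E₁ l u
        + (pd i (conn φ E₁ j) u - conn φ E₁ j u * conn E₁ E₂ i u) * conn φ E₂ l u) := by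
    intro l
    rw [h.pd_gram hu, h.pd_gram hu, h.pd_gram hu]
    linear_combination conn φ E₁ l u * h.pd_coframe₁_comm hu i j
      + conn φ E₁ j u * h.pd_coframe₁_comm hu l i + conn φ E₁ i u * h.pd_coframe₁_comm hu l j
      + conn φ E₂ l u * h.pd_coframe₂_comm hu i j
      + conn φ E₂ j u * h.pd_coframe₂_comm hu l i + conn φ E₂ i u * h.pd_coframe₂_comm hu l j
  have a1 := h.coframe_dualVec hu
  have a2 := h.coframe_dualVec' hu
  have a3 := h.swapTangent.coframe_dualVec hu
  have a4 := h.swapTangent.coframe_dualVec' hu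
  simp only [christoffel, hsum, h.gram_inv_eq hu]
  rw [Fin.sum_univ_two] at *
  generalize pd i (conn φ E₂ j) u + conn φ E₂ j u * conn E₁ E₂ i u = P
  generalize pd i (conn φ E₁ j) u - conn φ E₁ j u * conn E₁ E₂ i u = Q
  linear_combination
    dualVec (conn φ E₁) (conn φ E₂) k u * (P * a4 + Q * a1)
    + dualVec (conn φ E₂) (conn φ E₁) k u * (P * a3 + Q * a2)

theorem coframe_christoffel (h : IsNullFrame φ E₁ E₂ F₃ F₄ U) {u : Plane} (hu : u ∈ U)
    (i j : Fin 2) :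
    ∑ k, conn φ E₂ k u * christoffel φ k i j u
      = pd i (conn φ E₂ j) u + conn φ E₂ j u * conn E₁ E₂ i u := by
  have a1 := h.coframe_dualVec hu
  have a2 := h.coframe_dualVec' hu
  simp only [h.christoffel_eq hu]
  rw [Fin.sum_univ_two] at *
  linear_combination (pd i (conn φ E₂ j) u + conn φ E₂ j u * conn E₁ E₂ i u) * a1
    + (pd i (conn φ E₁ j) u - conn φ E₁ j u * conn E₁ E₂ i u) * a2

theorem contDiffOn_christoffel (h : IsNullFrame φ E₁ E₂ F₃ F₄ U) (k i j : Fin 2) :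
    ContDiffOn ℝ ∞ (christoffel φ k i j) U := by
  have hq := contDiffOn_conn h.isOpen h.smooth h.smooth₁
  have hp := contDiffOn_conn h.isOpen h.smooth h.smooth₂
  have hα := contDiffOn_conn h.isOpen h.smooth₁ h.smooth₂
  refine ContDiffOn.congr ?_ fun u hu => h.christoffel_eq hu k i j
  exact ((h.contDiffOn_dualVec k).mul
      ((contDiffOn_pd h.isOpen (hp j) i).add ((hp j).mul (hα i)))).add
    ((h.swapTangent.contDiffOn_dualVec k).mul
      ((contDiffOn_pd h.isOpen (hq j) i).sub ((hq j).mul (hα i))))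

/-- The component along `E₁` of a covariant derivative. -/
theorem coframe_covDeriv (h : IsNullFrame φ E₁ E₂ F₃ F₄ U) {u : Plane} (hu : u ∈ U)
    {V : Plane → Fin 2 → ℝ} (hV : ∀ k, DifferentiableAt ℝ (fun w => V w k) u) (i : Fin 2) :
    ∑ k, conn φ E₂ k u * covDeriv φ i V u k
      = pd i (fun w => ∑ k, conn φ E₂ k w * V w k) u
        + (∑ k, conn φ E₂ k u * V u k) * conn E₁ E₂ i u := by
  have hp := fun k => differentiableAt_of_contDiffOn h.isOpen
    (contDiffOn_conn h.isOpen h.smooth h.smooth₂ k) hu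
  have c := h.coframe_christoffel hu i
  simp only [covDeriv, Fin.sum_univ_two] at *
  rw [pd_add i ((hp 0).fun_mul (hV 0)) ((hp 1).fun_mul (hV 1)), pd_mul i (hp 0) (hV 0),
    pd_mul i (hp 1) (hV 1)]
  linear_combination V u 0 * c 0 + V u 1 * c 1

theorem coframe_covDeriv_covDeriv (h : IsNullFrame φ E₁ E₂ F₃ F₄ U) {u : Plane} (hu : u ∈ U)
    (i j k : Fin 2) :
    ∑ l, conn φ E₂ l u * covDeriv φ i (covDeriv φ j fun _ => Pi.single k 1) u l
      = pd i (pd j (conn φ E₂ k)) u + conn φ E₂ k u * pd i (conn E₁ E₂ j) u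
        + pd i (conn φ E₂ k) u * conn E₁ E₂ j u
        + (pd j (conn φ E₂ k) u + conn φ E₂ k u * conn E₁ E₂ j u) * conn E₁ E₂ i u := by
  have hp := contDiffOn_conn h.isOpen h.smooth h.smooth₂
  have hα := contDiffOn_conn h.isOpen h.smooth₁ h.smooth₂
  have h1 : ∀ w ∈ U, ∑ l, conn φ E₂ l w * covDeriv φ j (fun _ => Pi.single k 1) w l
      = pd j (conn φ E₂ k) w + conn φ E₂ k w * conn E₁ E₂ j w := by
    intro w hw
    rw [h.coframe_covDeriv (V := fun _ => Pi.single k 1) hw (fun _ => differentiableAt_const _)]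
    simp [Pi.single_apply]
  have h2 : ∀ l, DifferentiableAt ℝ (fun w => covDeriv φ j (fun _ => Pi.single k 1) w l) u := by
    intro l
    refine differentiableAt_of_contDiffOn h.isOpen ?_ hu
    refine (h.contDiffOn_christoffel l j k).congr fun w _ => ?_
    simp [covDeriv, pd, Pi.single_apply]
  have d := fun (i : Fin 2) => differentiableAt_of_contDiffOn h.isOpen (hp i) hu
  have dα := differentiableAt_of_contDiffOn h.isOpen (hα j) hu
  rw [h.coframe_covDeriv hu h2, h1 u hu,
    pd_congr i (Filter.eventually_of_mem (h.isOpen.mem_nhds hu) h1),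
    pd_add i (differentiableAt_of_contDiffOn h.isOpen (contDiffOn_pd h.isOpen (hp k) j) hu)
      ((d k).fun_mul dα), pd_mul i (d k) dα]
  ring

theorem coframe_riemann (h : IsNullFrame φ E₁ E₂ F₃ F₄ U) {u : Plane} (hu : u ∈ U)
    (k : Fin 2) :
    ∑ l, conn φ E₂ l u * riemann φ 0 1 k u l = conn φ E₂ k u * extD (conn E₁ E₂) u := by
  have c := pd_comm h.isOpen (contDiffOn_conn h.isOpen h.smooth h.smooth₂ k) hu 0 1
  have c1 := h.coframe_covDeriv_covDeriv hu 0 1 k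
  have c2 := h.coframe_covDeriv_covDeriv hu 1 0 k
  simp only [riemann, Pi.sub_apply, mul_sub, Finset.sum_sub_distrib, extD]
  rw [c1, c2, c]
  ring

/-- The Gaussian curvature is `-dα` divided by the area form. -/
theorem gaussK_mul_coframe (h : IsNullFrame φ E₁ E₂ F₃ F₄ U) {u : Plane} (hu : u ∈ U) :
    gaussK φ u * wedge (conn φ E₂) (conn φ E₁) u = -extD (conn E₁ E₂) u := by
  have hJ := h.coframe_ne u hu
  have r1 := h.coframe_riemann hu 1
  have r2 := h.swapTangent.coframe_riemann hu 1
  have e : extD (conn E₂ E₁) u = -extD (conn E₁ E₂) u := by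
    have : ∀ i j, pd i (conn E₂ E₁ j) u = -pd i (conn E₁ E₂ j) u := by
      intro i j
      rw [← pd_neg]
      exact pd_congr i (Filter.eventually_of_mem (h.isOpen.mem_nhds hu)
        fun w hw => h.conn_21 hw j)
    rw [extD, extD, this, this]
    ring
  rw [e] at r2
  have hden : gram φ u 0 0 * gram φ u 1 1 - gram φ u 0 1 ^ 2
      = -wedge (conn φ E₂) (conn φ E₁) u ^ 2 := by
    simp only [h.gram_eq hu, wedge]
    ring
  rw [gaussK, hden]
  simp only [h.gram_eq hu]
  rw [Fin.sum_univ_two] at *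
  rw [div_mul_eq_mul_div, div_eq_iff (neg_ne_zero.2 (pow_ne_zero 2 hJ))]
  generalize extD (conn E₁ E₂) u = D at *
  simp only [wedge] at *
  generalize riemann φ 0 1 1 u 0 = R0 at *
  generalize riemann φ 0 1 1 u 1 = R1 at *
  generalize conn φ E₂ 0 u = p0 at *
  generalize conn φ E₂ 1 u = p1 at *
  generalize conn φ E₁ 0 u = q0 at *
  generalize conn φ E₁ 1 u = q1 at *
  linear_combination (-(p0 * q1 - p1 * q0)) * (q0 * r1 + p0 * r2)

/-- The Gauss equation. -/
theorem gaussK_eq (h : IsNullFrame φ E₁ E₂ F₃ F₄ U) {u : Plane} (hu : u ∈ U)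
    (hm₃ : MixedVanishes φ E₁ E₂ F₃ u) (hm₄ : MixedVanishes φ E₁ E₂ F₄ u) :
    gaussK φ u = 1 + shape φ E₁ E₂ F₄ u * shape φ E₂ E₁ F₃ u
      + shape φ E₁ E₂ F₃ u * shape φ E₂ E₁ F₄ u := by
  apply mul_right_cancel₀ (h.coframe_ne u hu)
  rw [h.gaussK_mul_coframe hu, h.extD_tangent hu hm₃ hm₄]
  ring

theorem inner52_secondForm (h : IsNullFrame φ E₁ E₂ F₃ F₄ U) {u : Plane} (hu : u ∈ U)
    (i j : Fin 2) :
    inner52 (secondForm φ i j u) (F₃ u)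
      = -(conn φ E₂ j u * conn E₁ F₃ i u + conn φ E₁ j u * conn E₂ F₃ i u) := by
  have hq := fun k => differentiableAt_of_contDiffOn h.isOpen
    (contDiffOn_conn h.isOpen h.smooth h.smooth₁ k) hu
  have hp := fun k => differentiableAt_of_contDiffOn h.isOpen
    (contDiffOn_conn h.isOpen h.smooth h.smooth₂ k) hu
  have d1 := differentiableAt_of_contDiffOn h.isOpen h.smooth₁ hu
  have d2 := differentiableAt_of_contDiffOn h.isOpen h.smooth₂ hu
  have e : pd i (pd j φ) u
      = (conn φ E₂ j u • pd i E₁ u + pd i (conn φ E₂ j) u • E₁ u)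
        + (conn φ E₁ j u • pd i E₂ u + pd i (conn φ E₁ j) u • E₂ u) := by
    rw [← pd_smul i (hp j) d1, ← pd_smul i (hq j) d2,
      ← pd_add i ((hp j).fun_smul d1) ((hq j).fun_smul d2)]
    exact pd_congr i (Filter.eventually_of_mem (h.isOpen.mem_nhds hu)
      fun w hw => h.pd_position hw j)
  rw [secondForm, e, Fin.sum_univ_two]
  simp only [inner52_add_left, inner52_sub_left, inner52_smul_left, h.normal₃ u hu,
    h.inner_03 u hu, h.inner_13 u hu, h.inner_23 u hu, conn]
  ring

/-- Symmetry of the second fundamental form: `h(E₁, E₂)` and `h(E₂, E₁)` have the same product with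
`F₃`. -/
theorem conn_sym (h : IsNullFrame φ E₁ E₂ F₃ F₄ U) {u : Plane} (hu : u ∈ U) :
    wedge (conn φ E₂) (conn E₁ F₃) u + wedge (conn φ E₁) (conn E₂ F₃) u = 0 := by
  have h1 := h.extD_conn_eq h.smooth h.smooth₃ hu
  have h2 : ∀ i j, pd i (conn φ F₃ j) u = 0 := by
    intro i j
    rw [pd_congr (G := fun _ => (0 : ℝ)) i (Filter.eventually_of_mem (h.isOpen.mem_nhds hu)
      fun w hw => h.conn_03 hw j)]
    simp [pd]
  simp only [extD, wedge, h2, h.conn_self_pos hu, h.conn_31 hu, h.conn_32 hu, h.conn_03 hu,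
    h.conn_04 hu] at h1 ⊢
  linarith

/-- Vanishing mean curvature says that `h(E₁, E₂)` is orthogonal to `F₃`. -/
theorem mixedVanishes (h : IsNullFrame φ E₁ E₂ F₃ F₄ U) {u : Plane} (hu : u ∈ U)
    (hmin : meanCurv φ u = 0) : MixedVanishes φ E₁ E₂ F₃ u := by
  have hJ := h.coframe_ne u hu
  have h1 : inner52 (meanCurv φ u) (F₃ u) = 0 := by rw [hmin, inner52_zero_left]
  have h2 := h.conn_sym hu
  simp only [meanCurv, Fin.sum_univ_two, inner52_smul_left, inner52_add_left,
    h.inner52_secondForm hu, h.gram_inv_eq hu, dualVec] at h1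
  simp only [wedge, MixedVanishes] at *
  simp at h1
  have hs : conn φ E₁ 0 u * conn φ E₂ 1 u - conn φ E₁ 1 u * conn φ E₂ 0 u
    = -(conn φ E₂ 0 u * conn φ E₁ 1 u - conn φ E₂ 1 u * conn φ E₁ 0 u) := by ring
  rw [hs] at h1
  generalize hJJ : conn φ E₂ 0 u * conn φ E₁ 1 u - conn φ E₂ 1 u * conn φ E₁ 0 u = J at *
  field_simp at h1
  generalize conn φ E₂ 0 u = p0 at *
  generalize conn φ E₂ 1 u = p1 at *
  generalize conn φ E₁ 0 u = q0 at *
  generalize conn φ E₁ 1 u = q1 at *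
  have h3 : (conn E₁ F₃ 0 u * p1 - conn E₁ F₃ 1 u * p0)
      - (conn E₂ F₃ 0 u * q1 - conn E₂ F₃ 1 u * q0) = 0 := by
    apply mul_left_cancel₀ hJ
    rw [← hJJ]
    linear_combination -h1
  constructor <;> linarith

end IsNullFrame

/-! ### The normal curvature in terms of a null frame -/

namespace IsNullFrame

variable {φ E₁ E₂ F₃ F₄ : Plane → E52} {U : Set Plane}

theorem normalProj_eq (h : IsNullFrame φ E₁ E₂ F₃ F₄ U) {u : Plane} (hu : u ∈ U) (v : E52) :
    normalProj φ u v = -inner52 v (F₄ u) • F₃ u - inner52 v (F₃ u) • F₄ u := by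
  have a1 := h.coframe_dualVec hu
  have a2 := h.coframe_dualVec' hu
  have a3 := h.swapTangent.coframe_dualVec hu
  have a4 := h.swapTangent.coframe_dualVec' hu
  have e : ∑ i : Fin 2, ∑ j : Fin 2, ((gram φ u)⁻¹ i j * inner52 v (pd i φ u)) • pd j φ u
      = -inner52 v (E₂ u) • E₁ u - inner52 v (E₁ u) • E₂ u := by
    simp only [h.gram_inv_eq hu, h.pd_position hu, inner52_add_right, inner52_smul_right]
    rw [Fin.sum_univ_two] at *
    simp only [Fin.sum_univ_two]
    funext k
    simp only [Pi.add_apply, Pi.smul_apply, Pi.sub_apply, smul_eq_mul]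
    generalize dualVec (conn φ E₂) (conn φ E₁) 0 u = f0 at *
    generalize dualVec (conn φ E₂) (conn φ E₁) 1 u = f1 at *
    generalize dualVec (conn φ E₁) (conn φ E₂) 0 u = g0 at *
    generalize dualVec (conn φ E₁) (conn φ E₂) 1 u = g1 at *
    generalize conn φ E₂ 0 u = p0 at *
    generalize conn φ E₂ 1 u = p1 at *
    generalize conn φ E₁ 0 u = q0 at *
    generalize conn φ E₁ 1 u = q1 at *
    generalize inner52 v (E₁ u) = x at *
    generalize inner52 v (E₂ u) = y at *
    have X1 : f0 * (p0 * x + q0 * y) + f1 * (p1 * x + q1 * y) = x := by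
      linear_combination x * a1 + y * a4
    have X2 : g0 * (p0 * x + q0 * y) + g1 * (p1 * x + q1 * y) = y := by
      linear_combination x * a2 + y * a3
    have Y1 : f0 * (p0 * E₁ u k + q0 * E₂ u k) + f1 * (p1 * E₁ u k + q1 * E₂ u k) = E₁ u k := by
      linear_combination E₁ u k * a1 + E₂ u k * a4
    have Y2 : g0 * (p0 * E₁ u k + q0 * E₂ u k) + g1 * (p1 * E₁ u k + q1 * E₂ u k) = E₂ u k := by
      linear_combination E₁ u k * a2 + E₂ u k * a3
    linear_combination
      -(g0 * (p0 * E₁ u k + q0 * E₂ u k) + g1 * (p1 * E₁ u k + q1 * E₂ u k)) * X1 - x * Y2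
      - (f0 * (p0 * E₁ u k + q0 * E₂ u k) + f1 * (p1 * E₁ u k + q1 * E₂ u k)) * X2 - y * Y1
  rw [normalProj, e]
  nth_rewrite 1 [h.expansion hu v]
  module

/-- The normal connection has the connection form `β = -⟨dF₃, F₄⟩` in a null frame. -/
theorem normalDeriv_eq (h : IsNullFrame φ E₁ E₂ F₃ F₄ U) {u : Plane} (hu : u ∈ U)
    {r s : Plane → ℝ} (hr : DifferentiableAt ℝ r u) (hs : DifferentiableAt ℝ s u)
    {ξ : Plane → E52} (hξ : ∀ w ∈ U, ξ w = r w • F₃ w + s w • F₄ w) (i : Fin 2) :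
    normalDeriv φ i ξ u = (pd i r u + r u * conn F₃ F₄ i u) • F₃ u
      + (pd i s u - s u * conn F₃ F₄ i u) • F₄ u := by
  have d3 := differentiableAt_of_contDiffOn h.isOpen h.smooth₃ hu
  have d4 := differentiableAt_of_contDiffOn h.isOpen h.smooth₄ hu
  have e : pd i ξ u = (r u • pd i F₃ u + pd i r u • F₃ u)
      + (s u • pd i F₄ u + pd i s u • F₄ u) := by
    rw [← pd_smul i hr d3, ← pd_smul i hs d4, ← pd_add i (hr.fun_smul d3) (hs.fun_smul d4)]
    exact pd_congr i (Filter.eventually_of_mem (h.isOpen.mem_nhds hu) hξ)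
  have c33 := h.conn_33 hu i
  have c44 := h.conn_44 hu i
  have c43 := h.conn_43 hu i
  have i43 : inner52 (F₄ u) (F₃ u) = -1 := h.swap.inner_34 u hu
  rw [conn, neg_eq_zero] at c33 c44
  rw [conn, neg_eq_iff_eq_neg, neg_neg] at c43
  have e2 : inner52 (pd i F₃ u) (F₄ u) = -conn F₃ F₄ i u := by rw [conn, neg_neg]
  rw [normalDeriv, h.normalProj_eq hu, e]
  simp only [inner52_add_left, inner52_smul_left, c33, c44, c43, e2, h.inner_33 u hu,
    h.inner_34 u hu, h.inner_44 u hu, i43]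
  module

theorem normalR_eq (h : IsNullFrame φ E₁ E₂ F₃ F₄ U) {u : Plane} (hu : u ∈ U) (a b : Plane)
    (ξ : E52) :
    normalR φ u a b ξ = ((a 0 * b 1 - a 1 * b 0) * extD (conn F₃ F₄) u) •
      (inner52 ξ (F₃ u) • F₄ u - inner52 ξ (F₄ u) • F₃ u) := by
  set r : Plane → ℝ := fun w => -inner52 ξ (F₄ w) with hr
  set s : Plane → ℝ := fun w => -inner52 ξ (F₃ w) with hs
  have sr : ContDiffOn ℝ ∞ r U := (contDiffOn_inner52 contDiffOn_const h.smooth₄).neg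
  have ss : ContDiffOn ℝ ∞ s U := (contDiffOn_inner52 contDiffOn_const h.smooth₃).neg
  have sβ := contDiffOn_conn h.isOpen h.smooth₃ h.smooth₄
  have dr := fun {w : Plane} (hw : w ∈ U) => differentiableAt_of_contDiffOn h.isOpen sr hw
  have ds := fun {w : Plane} (hw : w ∈ U) => differentiableAt_of_contDiffOn h.isOpen ss hw
  have dβ := fun i => differentiableAt_of_contDiffOn h.isOpen (sβ i) hu
  have h0 : ∀ w ∈ U, normalProj φ w ξ = r w • F₃ w + s w • F₄ w := by
    intro w hw
    rw [h.normalProj_eq hw]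
    module
  have key : ∀ i j, normalDeriv φ i (normalDeriv φ j fun w => normalProj φ w ξ) u
      = (pd i (pd j r) u + (r u * pd i (conn F₃ F₄ j) u + pd i r u * conn F₃ F₄ j u)
          + (pd j r u + r u * conn F₃ F₄ j u) * conn F₃ F₄ i u) • F₃ u
        + (pd i (pd j s) u - (s u * pd i (conn F₃ F₄ j) u + pd i s u * conn F₃ F₄ j u)
          - (pd j s u - s u * conn F₃ F₄ j u) * conn F₃ F₄ i u) • F₄ u := by
    intro i j
    have d1 := differentiableAt_of_contDiffOn h.isOpen (contDiffOn_pd h.isOpen sr j) hu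
    have d2 := differentiableAt_of_contDiffOn h.isOpen (contDiffOn_pd h.isOpen ss j) hu
    have d3 := (dr hu).fun_mul (dβ j)
    have d4 := (ds hu).fun_mul (dβ j)
    rw [h.normalDeriv_eq (r := fun w => pd j r w + r w * conn F₃ F₄ j w)
      (s := fun w => pd j s w + -(s w * conn F₃ F₄ j w)) hu (d1.fun_add d3)
      (d2.fun_add d4.fun_neg)
      (fun w hw => by
        rw [h.normalDeriv_eq hw (dr hw) (ds hw) h0 j]
        module) i,
      pd_add i d1 d3, pd_add i d2 d4.fun_neg,
      pd_neg (r := fun w => s w * conn F₃ F₄ j w), pd_mul i (dr hu) (dβ j),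
      pd_mul i (ds hu) (dβ j)]
    module
  have c1 := pd_comm h.isOpen sr hu 0 1
  have c2 := pd_comm h.isOpen ss hu 0 1
  have er : inner52 ξ (F₄ u) = -r u := by simp [hr]
  have es : inner52 ξ (F₃ u) = -s u := by simp [hs]
  simp only [normalR, Fin.sum_univ_two, key, c1, c2, extD, er, es]
  module

/-- The normal curvature is `dβ` divided by the area form, for a frame of positive orientation. -/
theorem normalK_mul_coframe (h : IsNullFrame φ E₁ E₂ F₃ F₄ U) {u : Plane} (hu : u ∈ U)
    (hdet : 0 < (Matrix.of ![E₁ u, E₂ u, F₃ u, F₄ u, φ u]).det)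
    (hne : Nonempty (PosNullFrame φ u)) :
    normalK φ u * wedge (conn φ E₂) (conn φ E₁) u = extD (conn F₃ F₄) u := by
  rw [normalK, dif_pos hne, h.normalR_eq hu]
  generalize hne.some = f
  -- components of the tangent vectors `f₁`, `f₂` and of the normal vectors `f₃`, `f₄`
  set P : Plane → ℝ := fun a => a 0 * conn φ E₂ 0 u + a 1 * conn φ E₂ 1 u with hP
  set Q : Plane → ℝ := fun a => a 0 * conn φ E₁ 0 u + a 1 * conn φ E₁ 1 u with hQ
  have t : ∀ a : Plane, fderiv ℝ φ u a = P a • E₁ u + Q a • E₂ u := by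
    intro a
    rw [fderiv_apply_eq_sum_pd, h.pd_position hu, h.pd_position hu, hP, hQ]
    module
  have i21 : inner52 (E₂ u) (E₁ u) = -1 := h.swapTangent.inner_12 u hu
  have ff : ∀ a b : Plane, firstForm φ u a b = -(P a * Q b + Q a * P b) := by
    intro a b
    simp only [firstForm, t, inner52_add_left, inner52_add_right, inner52_smul_left,
      inner52_smul_right, h.inner_11 u hu, h.inner_12 u hu, h.inner_22 u hu, i21]
    ring
  have hE1 : fderiv ℝ φ u (WithLp.toLp 2 fun k => dualVec (conn φ E₂) (conn φ E₁) k u) = E₁ u := by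
    have a1 := h.coframe_dualVec hu
    have a4 := h.swapTangent.coframe_dualVec' hu
    rw [Fin.sum_univ_two] at a1 a4
    have e1 : P (WithLp.toLp 2 fun k => dualVec (conn φ E₂) (conn φ E₁) k u) = 1 := by
      rw [← a1, hP]
      simp only []
      ring
    have e2 : Q (WithLp.toLp 2 fun k => dualVec (conn φ E₂) (conn φ E₁) k u) = 0 := by
      rw [← a4, hQ]
      simp only []
      ring
    rw [t, e1, e2]
    module
  have hE2 : fderiv ℝ φ u (WithLp.toLp 2 fun k => dualVec (conn φ E₁) (conn φ E₂) k u) = E₂ u := by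
    have a1 := h.swapTangent.coframe_dualVec hu
    have a4 := h.coframe_dualVec' hu
    rw [Fin.sum_univ_two] at a1 a4
    have e1 : Q (WithLp.toLp 2 fun k => dualVec (conn φ E₁) (conn φ E₂) k u) = 1 := by
      rw [← a1, hQ]
      simp only []
      ring
    have e2 : P (WithLp.toLp 2 fun k => dualVec (conn φ E₁) (conn φ E₂) k u) = 0 := by
      rw [← a4, hP]
      simp only []
      ring
    rw [t, e1, e2]
    module
  have n31 : inner52 f.f₃ (E₁ u) = 0 := by rw [← hE1]; exact f.normal_3 _
  have n32 : inner52 f.f₃ (E₂ u) = 0 := by rw [← hE2]; exact f.normal_3 _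
  have n41 : inner52 f.f₄ (E₁ u) = 0 := by rw [← hE1]; exact f.normal_4 _
  have n42 : inner52 f.f₄ (E₂ u) = 0 := by rw [← hE2]; exact f.normal_4 _
  have x3 := h.expansion hu f.f₃
  have x4 := h.expansion hu f.f₄
  have p33 := h.parseval hu f.f₃ f.f₃
  have p34 := h.parseval hu f.f₃ f.f₄
  rw [f.normal_3_pos, n31, n32] at x3
  rw [f.normal_4_pos, n41, n42] at x4
  rw [f.normal_33, f.normal_3_pos, n31, n32] at p33
  rw [f.normal_34, f.normal_3_pos, n31, n32, f.normal_4_pos, n41, n42] at p34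
  have t11 := f.tangent_11
  have t12 := f.tangent_12
  rw [ff] at t11 t12
  have hpos := f.normal_orient
  have hmat : (Matrix.of ![fderiv ℝ φ u f.f₁, fderiv ℝ φ u f.f₂, f.f₃, f.f₄, φ u])
      = !![P f.f₁, Q f.f₁, 0, 0, 0; P f.f₂, Q f.f₂, 0, 0, 0;
          0, 0, -inner52 f.f₃ (F₄ u), -inner52 f.f₃ (F₃ u), 0;
          0, 0, -inner52 f.f₄ (F₄ u), -inner52 f.f₄ (F₃ u), 0; 0, 0, 0, 0, 1]
        * Matrix.of ![E₁ u, E₂ u, F₃ u, F₄ u, φ u] := by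
    ext i j
    rw [Matrix.mul_apply, Fin.sum_univ_five]
    have y3 := congrFun x3 j
    have y4 := congrFun x4 j
    simp only [Pi.sub_apply, Pi.smul_apply, smul_eq_mul] at y3 y4
    fin_cases i
    · simp [t]
    · simp [t]
    · simp; linarith
    · simp; linarith
    · simp
  have hdetC : (!![P f.f₁, Q f.f₁, 0, 0, 0; P f.f₂, Q f.f₂, 0, 0, 0;
          0, 0, -inner52 f.f₃ (F₄ u), -inner52 f.f₃ (F₃ u), 0;
          0, 0, -inner52 f.f₄ (F₄ u), -inner52 f.f₄ (F₃ u), 0; 0, 0, 0, 0, 1] :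
            Matrix (Fin 5) (Fin 5) ℝ).det
      = (P f.f₁ * Q f.f₂ - Q f.f₁ * P f.f₂) * (inner52 f.f₃ (F₄ u) * inner52 f.f₄ (F₃ u)
        - inner52 f.f₃ (F₃ u) * inner52 f.f₄ (F₄ u)) := by
    simp [Matrix.det_succ_row_zero, Fin.sum_univ_succ, Fin.succAbove]
    ring
  rw [hmat, Matrix.det_mul, hdetC] at hpos
  have hpos' := pos_of_mul_pos_left hpos hdet.le
  have hPQ : P f.f₁ * Q f.f₂ - Q f.f₁ * P f.f₂
      = (f.f₁ 0 * f.f₂ 1 - f.f₁ 1 * f.f₂ 0) * wedge (conn φ E₂) (conn φ E₁) u := by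
    simp only [hP, hQ, wedge]
    ring
  have i43 : inner52 (F₄ u) f.f₄ = inner52 f.f₄ (F₄ u) := inner52_comm _ _
  have i33 : inner52 (F₃ u) f.f₄ = inner52 f.f₄ (F₃ u) := inner52_comm _ _
  simp only [inner52_smul_left, inner52_sub_left, i43, i33]
  generalize inner52 f.f₃ (F₃ u) = x at *
  generalize inner52 f.f₃ (F₄ u) = y at *
  generalize inner52 f.f₄ (F₃ u) = z at *
  generalize inner52 f.f₄ (F₄ u) = w at *
  -- both factors of the determinant have square `1`, so that their product, being positive, is `1`
  have s1 : (P f.f₁ * Q f.f₂ - Q f.f₁ * P f.f₂) ^ 2 = 1 := by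
    linear_combination (-(P f.f₁ * Q f.f₂ + Q f.f₁ * P f.f₂ + 1)) * t12
      + 2 * (P f.f₂ * Q f.f₂) * t11
  have s2 : (y * z - x * w) ^ 2 = 1 := by
    linear_combination (y * z + x * w + 1) * p34 - 2 * (z * w) * p33
  have s3 : (P f.f₁ * Q f.f₂ - Q f.f₁ * P f.f₂) * (y * z - x * w) = 1 := by
    rw [← pow_eq_one_iff_of_nonneg hpos'.le two_ne_zero, mul_pow, s1, s2, one_mul]
  rw [hPQ] at s3
  linear_combination extD (conn F₃ F₄) u * s3

/-- The Ricci equation. -/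
theorem normalK_eq (h : IsNullFrame φ E₁ E₂ F₃ F₄ U) {u : Plane} (hu : u ∈ U)
    (hdet : 0 < (Matrix.of ![E₁ u, E₂ u, F₃ u, F₄ u, φ u]).det)
    (hne : Nonempty (PosNullFrame φ u))
    (hm₃ : MixedVanishes φ E₁ E₂ F₃ u) (hm₄ : MixedVanishes φ E₁ E₂ F₄ u) :
    normalK φ u = shape φ E₁ E₂ F₄ u * shape φ E₂ E₁ F₃ u
      - shape φ E₁ E₂ F₃ u * shape φ E₂ E₁ F₄ u := by
  apply mul_right_cancel₀ (h.coframe_ne u hu)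
  rw [h.normalK_mul_coframe hu hdet hne, h.extD_normal hu hm₃ hm₄]

end IsNullFrame

/-! ### Existence of null frames -/

/-- Two vector fields that are orthogonal, of time-like and space-like direction, at one point span
near this point a plane with a smooth null basis. -/
theorem exists_null_basis {X Y : Plane → E52} {U : Set Plane} (hU : IsOpen U)
    (hX : ContDiffOn ℝ ∞ X U) (hY : ContDiffOn ℝ ∞ Y U) {u₀ : Plane} (hu₀ : u₀ ∈ U)
    (hXX : inner52 (X u₀) (X u₀) < 0) (hXY : inner52 (X u₀) (Y u₀) = 0)
    (hYY : 0 < inner52 (Y u₀) (Y u₀)) :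
    ∃ (V : Set Plane) (p q r s : Plane → ℝ), IsOpen V ∧ V ⊆ U ∧ u₀ ∈ V ∧
      ContDiffOn ℝ ∞ p V ∧ ContDiffOn ℝ ∞ q V ∧ ContDiffOn ℝ ∞ r V ∧ ContDiffOn ℝ ∞ s V ∧
      ∀ u ∈ V, inner52 (p u • X u + q u • Y u) (p u • X u + q u • Y u) = 0 ∧
        inner52 (p u • X u + q u • Y u) (r u • X u + s u • Y u) = -1 ∧
        inner52 (r u • X u + s u • Y u) (r u • X u + s u • Y u) = 0 := by
  set A : Plane → ℝ := fun u => inner52 (X u) (X u)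
  set B : Plane → ℝ := fun u => inner52 (X u) (Y u)
  set C : Plane → ℝ := fun u => inner52 (Y u) (Y u)
  have sA : ContDiffOn ℝ ∞ A U := contDiffOn_inner52 hX hX
  have sB : ContDiffOn ℝ ∞ B U := contDiffOn_inner52 hX hY
  have sC : ContDiffOn ℝ ∞ C U := contDiffOn_inner52 hY hY
  have hV₁ : IsOpen (U ∩ A ⁻¹' Set.Iio 0) := sA.continuousOn.isOpen_inter_preimage hU isOpen_Iio
  have sA₁ : ContDiffOn ℝ ∞ A (U ∩ A ⁻¹' Set.Iio 0) := sA.mono Set.inter_subset_left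
  set t : Plane → ℝ := fun u => B u / A u with ht
  have st : ContDiffOn ℝ ∞ t (U ∩ A ⁻¹' Set.Iio 0) :=
    (sB.mono Set.inter_subset_left).div sA₁ fun u hu => ne_of_lt hu.2
  -- `D` is the square length of the component `Y - t X` of `Y` orthogonal to `X`
  set D : Plane → ℝ := fun u => C u - t u ^ 2 * A u with hD
  have sD : ContDiffOn ℝ ∞ D (U ∩ A ⁻¹' Set.Iio 0) :=
    (sC.mono Set.inter_subset_left).sub ((st.pow 2).mul sA₁)
  set V := (U ∩ A ⁻¹' Set.Iio 0) ∩ D ⁻¹' Set.Ioi 0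
  have hVo : IsOpen V := sD.continuousOn.isOpen_inter_preimage hV₁ isOpen_Ioi
  set x : Plane → ℝ := fun u => (√(-A u))⁻¹ with hx
  set y : Plane → ℝ := fun u => (√(D u))⁻¹ with hy
  have nA : ∀ u ∈ V, 0 < -A u := fun u hu => neg_pos.2 hu.1.2
  have nD : ∀ u ∈ V, 0 < D u := fun u hu => hu.2
  have stV : ContDiffOn ℝ ∞ t V := st.mono Set.inter_subset_left
  have sx : ContDiffOn ℝ ∞ x V :=
    ((sA₁.mono Set.inter_subset_left).neg.sqrt fun u hu => (nA u hu).ne').inv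
      fun u hu => (Real.sqrt_pos.2 (nA u hu)).ne'
  have sy : ContDiffOn ℝ ∞ y V :=
    ((sD.mono Set.inter_subset_left).sqrt fun u hu => (nD u hu).ne').inv
      fun u hu => (Real.sqrt_pos.2 (nD u hu)).ne'
  refine ⟨V, fun u => x u - t u * y u, y, fun u => (1 / 2) * (x u + t u * y u),
    fun u => (-1 / 2) * y u, hVo, fun u hu => hu.1.1, ⟨⟨hu₀, hXX⟩, ?_⟩, sx.sub (stV.mul sy), sy,
    contDiffOn_const.mul (sx.add (stV.mul sy)), contDiffOn_const.mul sy, ?_⟩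
  · show 0 < C u₀ - (B u₀ / A u₀) ^ 2 * A u₀
    have hB0 : B u₀ = 0 := hXY
    rw [hB0]
    simpa using hYY
  · intro u hu
    have eA : x u ^ 2 * A u = -1 := by
      have h := Real.sq_sqrt (nA u hu).le
      simp only [hx]
      rw [inv_pow, h, inv_neg, neg_mul, inv_mul_cancel₀ (neg_ne_zero.1 (nA u hu).ne')]
    have eD : y u ^ 2 * D u = 1 := by
      have h := Real.sq_sqrt (nD u hu).le
      simp only [hy]
      rw [inv_pow, h, inv_mul_cancel₀ (nD u hu).ne']
    have eB : B u = t u * A u := by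
      simp only [ht]
      rw [div_mul_cancel₀ _ (ne_of_lt hu.1.2)]
    have eC : C u = D u + t u ^ 2 * A u := by
      simp only [hD]
      ring
    have iXX : inner52 (X u) (X u) = A u := rfl
    have iXY : inner52 (X u) (Y u) = t u * A u := eB
    have iYX : inner52 (Y u) (X u) = t u * A u := by rw [inner52_comm, iXY]
    have iYY : inner52 (Y u) (Y u) = D u + t u ^ 2 * A u := eC
    simp only [inner52_add_left, inner52_add_right, inner52_smul_left, inner52_smul_right,
      iXX, iXY, iYX, iYY]
    refine ⟨?_, ?_, ?_⟩
    · linear_combination eA + eD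
    · linear_combination (1 / 2) * eA - (1 / 2) * eD
    · linear_combination (1 / 4) * eA + (1 / 4) * eD

theorem frameDet_ne_zero {φ E₁ E₂ F₃ F₄ : Plane → E52} {U : Set Plane}
    (h : IsNullFrame φ E₁ E₂ F₃ F₄ U) {u : Plane} (hu : u ∈ U) :
    (Matrix.of ![E₁ u, E₂ u, F₃ u, F₄ u, φ u] : Matrix (Fin 5) (Fin 5) ℝ).det ≠ 0 := by
  have h1 := frameMatrix_mul (h.inner_00 u hu) (h.inner_01 u hu) (h.inner_02 u hu)
    (h.inner_03 u hu) (h.inner_04 u hu) (h.inner_11 u hu) (h.inner_12 u hu) (h.inner_22 u hu)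
    (h.inner_13 u hu) (h.inner_14 u hu) (h.inner_23 u hu) (h.inner_24 u hu) (h.inner_33 u hu)
    (h.inner_34 u hu) (h.inner_44 u hu)
  have h2 := congrArg Matrix.det h1
  rw [Matrix.det_mul, Matrix.det_one] at h2
  exact left_ne_zero_of_mul_eq_one h2

theorem IsNullFrame.mono {φ E₁ E₂ F₃ F₄ : Plane → E52} {U V : Set Plane}
    (h : IsNullFrame φ E₁ E₂ F₃ F₄ U) (hV : IsOpen V) (hVU : V ⊆ U) :
    IsNullFrame φ E₁ E₂ F₃ F₄ V where
  isOpen := hV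
  smooth := h.smooth.mono hVU
  smooth₁ := h.smooth₁.mono hVU
  smooth₂ := h.smooth₂.mono hVU
  smooth₃ := h.smooth₃.mono hVU
  smooth₄ := h.smooth₄.mono hVU
  inner_00 := fun u hu => h.inner_00 u (hVU hu)
  inner_01 := fun u hu => h.inner_01 u (hVU hu)
  inner_02 := fun u hu => h.inner_02 u (hVU hu)
  inner_03 := fun u hu => h.inner_03 u (hVU hu)
  inner_04 := fun u hu => h.inner_04 u (hVU hu)
  inner_11 := fun u hu => h.inner_11 u (hVU hu)
  inner_12 := fun u hu => h.inner_12 u (hVU hu)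
  inner_22 := fun u hu => h.inner_22 u (hVU hu)
  inner_13 := fun u hu => h.inner_13 u (hVU hu)
  inner_14 := fun u hu => h.inner_14 u (hVU hu)
  inner_23 := fun u hu => h.inner_23 u (hVU hu)
  inner_24 := fun u hu => h.inner_24 u (hVU hu)
  inner_33 := fun u hu => h.inner_33 u (hVU hu)
  inner_34 := fun u hu => h.inner_34 u (hVU hu)
  inner_44 := fun u hu => h.inner_44 u (hVU hu)
  normal₃ := fun u hu => h.normal₃ u (hVU hu)
  normal₄ := fun u hu => h.normal₄ u (hVU hu)
  coframe_ne := fun u hu => h.coframe_ne u (hVU hu)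

theorem det_swap_frame (e₁ e₂ f₃ f₄ x : E52) :
    (Matrix.of ![e₁, e₂, f₄, f₃, x] : Matrix (Fin 5) (Fin 5) ℝ).det
      = -(Matrix.of ![e₁, e₂, f₃, f₄, x] : Matrix (Fin 5) (Fin 5) ℝ).det := by
  have h := Matrix.det_permute (Equiv.swap (2 : Fin 5) 3)
    (Matrix.of ![e₁, e₂, f₃, f₄, x] : Matrix (Fin 5) (Fin 5) ℝ)
  rw [Equiv.Perm.sign_swap (by decide)] at h
  have e : (Matrix.of ![e₁, e₂, f₄, f₃, x] : Matrix (Fin 5) (Fin 5) ℝ)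
      = (Matrix.of ![e₁, e₂, f₃, f₄, x]).submatrix (Equiv.swap (2 : Fin 5) 3) id := by
    ext i j
    fin_cases i <;> rfl
  rw [e, h]
  simp

theorem continuousOn_frameDet {φ E₁ E₂ F₃ F₄ : Plane → E52} {U : Set Plane}
    (h : IsNullFrame φ E₁ E₂ F₃ F₄ U) :
    ContinuousOn (fun u => (Matrix.of ![E₁ u, E₂ u, F₃ u, F₄ u, φ u] :
      Matrix (Fin 5) (Fin 5) ℝ).det) U := by
  have hM : ContinuousOn (fun u => (Matrix.of ![E₁ u, E₂ u, F₃ u, F₄ u, φ u] :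
      Matrix (Fin 5) (Fin 5) ℝ)) U := by
    refine continuousOn_pi.2 fun i => ?_
    fin_cases i
    · exact h.smooth₁.continuousOn
    · exact h.smooth₂.continuousOn
    · exact h.smooth₃.continuousOn
    · exact h.smooth₄.continuousOn
    · exact h.smooth.continuousOn
  obtain ⟨d, hd, e⟩ : ∃ d : Matrix (Fin 5) (Fin 5) ℝ → ℝ, Continuous d ∧ ∀ M, M.det = d M :=
    ⟨fun M => M.det, Continuous.matrix_det continuous_id, fun _ => rfl⟩
  simp only [e]
  exact hd.comp_continuousOn hM

/-- Near a point with a pseudo-orthonormal frame there is a smooth null frame of positive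
orientation. -/
theorem exists_nullFrame {φ : Plane → E52} {W : Set Plane} (hW : IsOpen W)
    (hφ : ContDiffOn ℝ ∞ φ W) (hS : ∀ u ∈ W, φ u ∈ S42) {u₀ : Plane} (hu₀ : u₀ ∈ W)
    (f : PosNullFrame φ u₀) :
    ∃ (U : Set Plane) (E₁ E₂ F₃ F₄ : Plane → E52), U ⊆ W ∧ u₀ ∈ U ∧
      IsNullFrame φ E₁ E₂ F₃ F₄ U ∧
      ∀ u ∈ U, 0 < (Matrix.of ![E₁ u, E₂ u, F₃ u, F₄ u, φ u] : Matrix (Fin 5) (Fin 5) ℝ).det := by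
  have s0 := contDiffOn_pd hW hφ 0
  have s1 := contDiffOn_pd hW hφ 1
  have hlin : ∀ a : Plane, ContDiffOn ℝ ∞ (fun u => a 0 • pd 0 φ u + a 1 • pd 1 φ u) W :=
    fun a => (s0.const_smul (a 0)).add (s1.const_smul (a 1))
  have t11 := f.tangent_11
  have t12 := f.tangent_12
  have t22 := f.tangent_22
  simp only [firstForm] at t11 t12 t22
  have t21 := t12
  rw [inner52_comm] at t21
  -- `f₁ + f₂, f₁ - f₂` are orthogonal, of square length `-2, 2`; so are the normal `f₃ + f₄, f₃ - f₄`
  have eX : (f.f₁ + f.f₂) 0 • pd 0 φ u₀ + (f.f₁ + f.f₂) 1 • pd 1 φ u₀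
      = fderiv ℝ φ u₀ f.f₁ + fderiv ℝ φ u₀ f.f₂ := by
    rw [← fderiv_apply_eq_sum_pd, map_add]
  have eY : (f.f₁ - f.f₂) 0 • pd 0 φ u₀ + (f.f₁ - f.f₂) 1 • pd 1 φ u₀
      = fderiv ℝ φ u₀ f.f₁ - fderiv ℝ φ u₀ f.f₂ := by
    rw [← fderiv_apply_eq_sum_pd, map_sub]
  obtain ⟨V, p, q, r, s, hVo, hVW, hu₀V, sp, sq, sr, ss, hE⟩ :=
    exists_null_basis hW (hlin (f.f₁ + f.f₂)) (hlin (f.f₁ - f.f₂)) hu₀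
      (by
        rw [eX]
        simp only [inner52_add_left, inner52_add_right, t11, t12, t21, t22]
        norm_num)
      (by
        rw [eX, eY]
        simp only [inner52_add_left, inner52_sub_right, t11, t12, t21, t22]
        norm_num)
      (by
        rw [eY]
        simp only [inner52_sub_left, inner52_sub_right, t11, t12, t21, t22]
        norm_num)
  set X : Plane → E52 := fun u => (f.f₁ + f.f₂) 0 • pd 0 φ u + (f.f₁ + f.f₂) 1 • pd 1 φ u with hX
  set Y : Plane → E52 := fun u => (f.f₁ - f.f₂) 0 • pd 0 φ u + (f.f₁ - f.f₂) 1 • pd 1 φ u with hY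
  set E₁ : Plane → E52 := fun u => p u • X u + q u • Y u with hE₁
  set E₂ : Plane → E52 := fun u => r u • X u + s u • Y u with hE₂
  have sφV := hφ.mono hVW
  have sX : ContDiffOn ℝ ∞ X V := (hlin _).mono hVW
  have sY : ContDiffOn ℝ ∞ Y V := (hlin _).mono hVW
  have sE₁ : ContDiffOn ℝ ∞ E₁ V := (sp.smul sX).add (sq.smul sY)
  have sE₂ : ContDiffOn ℝ ∞ E₂ V := (sr.smul sX).add (ss.smul sY)
  have i11 : ∀ u ∈ V, inner52 (E₁ u) (E₁ u) = 0 := fun u hu => (hE u hu).1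
  have i12 : ∀ u ∈ V, inner52 (E₁ u) (E₂ u) = -1 := fun u hu => (hE u hu).2.1
  have i22 : ∀ u ∈ V, inner52 (E₂ u) (E₂ u) = 0 := fun u hu => (hE u hu).2.2
  have i21 : ∀ u ∈ V, inner52 (E₂ u) (E₁ u) = -1 := fun u hu => by
    rw [inner52_comm]
    exact i12 u hu
  have i00 : ∀ u ∈ V, inner52 (φ u) (φ u) = 1 := fun u hu => hS u (hVW hu)
  have iφd : ∀ u ∈ V, ∀ i, inner52 (φ u) (pd i φ u) = 0 := by
    intro u hu i
    have h1 := inner52_pd_swap hVo sφV sφV i00 hu i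
    rw [inner52_comm (pd i φ u)] at h1
    linarith
  have ortho : ∀ u, ∀ v : E52, (∀ i, inner52 v (pd i φ u) = 0) →
      inner52 v (E₁ u) = 0 ∧ inner52 v (E₂ u) = 0 := by
    intro u v hv
    simp [hE₁, hE₂, hX, hY, inner52_add_right, inner52_smul_right, hv]
  have i01 : ∀ u ∈ V, inner52 (φ u) (E₁ u) = 0 := fun u hu => (ortho u _ (iφd u hu)).1
  have i02 : ∀ u ∈ V, inner52 (φ u) (E₂ u) = 0 := fun u hu => (ortho u _ (iφd u hu)).2
  -- the coordinates of `E₁, E₂` with respect to `∂₀φ, ∂₁φ` form a matrix inverse to the coframe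
  obtain ⟨c, hc₁, hc₂⟩ : ∃ c : Fin 2 → Fin 2 → Plane → ℝ,
      (∀ u, E₁ u = c 0 0 u • pd 0 φ u + c 0 1 u • pd 1 φ u) ∧
      (∀ u, E₂ u = c 1 0 u • pd 0 φ u + c 1 1 u • pd 1 φ u) := by
    refine ⟨![![fun u => p u * (f.f₁ + f.f₂) 0 + q u * (f.f₁ - f.f₂) 0,
      fun u => p u * (f.f₁ + f.f₂) 1 + q u * (f.f₁ - f.f₂) 1],
      ![fun u => r u * (f.f₁ + f.f₂) 0 + s u * (f.f₁ - f.f₂) 0,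
      fun u => r u * (f.f₁ + f.f₂) 1 + s u * (f.f₁ - f.f₂) 1]], fun u => ?_, fun u => ?_⟩
    · simp only [hE₁, hX, hY, Matrix.cons_val_zero, Matrix.cons_val_one]
      module
    · simp only [hE₂, hX, hY, Matrix.cons_val_zero, Matrix.cons_val_one]
      module
  have hJ : ∀ u ∈ V, wedge (conn φ E₂) (conn φ E₁) u
      * (c 0 0 u * c 1 1 u - c 0 1 u * c 1 0 u) = 1 := by
    intro u hu
    have g11 := i11 u hu
    have g12 := i12 u hu
    have g21 := i21 u hu
    have g22 := i22 u hu
    nth_rewrite 1 [hc₁ u] at g11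
    nth_rewrite 1 [hc₁ u] at g12
    nth_rewrite 1 [hc₂ u] at g21
    nth_rewrite 1 [hc₂ u] at g22
    simp only [inner52_add_left, inner52_smul_left] at g11 g12 g21 g22
    simp only [wedge, conn]
    generalize inner52 (pd 0 φ u) (E₁ u) = a at *
    generalize inner52 (pd 1 φ u) (E₁ u) = b at *
    generalize inner52 (pd 0 φ u) (E₂ u) = a' at *
    generalize inner52 (pd 1 φ u) (E₂ u) = b' at *
    linear_combination (c 1 0 u * a + c 1 1 u * b) * g12 - (c 1 0 u * a' + c 1 1 u * b') * g11
      - g21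
  have hdual : ∀ u ∈ V, ∀ v : E52, inner52 v (E₁ u) = 0 → inner52 v (E₂ u) = 0 →
      ∀ i, inner52 (pd i φ u) v = 0 := by
    intro u hu v h1 h2 i
    rw [hc₁ u, inner52_add_right, inner52_smul_right, inner52_smul_right] at h1
    rw [hc₂ u, inner52_add_right, inner52_smul_right, inner52_smul_right] at h2
    have hne := right_ne_zero_of_mul_eq_one (hJ u hu)
    rw [inner52_comm]
    fin_cases i
    · apply mul_left_cancel₀ hne
      simp only [Fin.zero_eta]
      linear_combination c 1 1 u * h1 - c 0 1 u * h2
    · apply mul_left_cancel₀ hne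
      simp only [Fin.mk_one]
      linear_combination c 0 0 u * h2 - c 1 0 u * h1
  -- the projection of a constant vector to the normal plane
  set N : E52 → Plane → E52 := fun v u => v - inner52 v (φ u) • φ u + inner52 v (E₂ u) • E₁ u
    + inner52 v (E₁ u) • E₂ u with hN
  have sN : ∀ v, ContDiffOn ℝ ∞ (N v) V := fun v =>
    ((contDiffOn_const.sub ((contDiffOn_inner52 contDiffOn_const sφV).smul sφV)).add
      ((contDiffOn_inner52 contDiffOn_const sE₂).smul sE₁)).add
      ((contDiffOn_inner52 contDiffOn_const sE₁).smul sE₂)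
  have N0 : ∀ v, ∀ u ∈ V, inner52 (φ u) (N v u) = 0 := by
    intro v u hu
    simp only [hN, inner52_add_right, inner52_sub_right, inner52_smul_right, i00 u hu, i01 u hu,
      i02 u hu]
    rw [inner52_comm (φ u) v]
    ring
  have N1 : ∀ v, ∀ u ∈ V, inner52 (E₁ u) (N v u) = 0 := by
    intro v u hu
    simp only [hN, inner52_add_right, inner52_sub_right, inner52_smul_right, i11 u hu, i12 u hu]
    rw [inner52_comm (E₁ u) v, inner52_comm (E₁ u) (φ u), i01 u hu]
    ring
  have N2 : ∀ v, ∀ u ∈ V, inner52 (E₂ u) (N v u) = 0 := by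
    intro v u hu
    simp only [hN, inner52_add_right, inner52_sub_right, inner52_smul_right, i21 u hu, i22 u hu]
    rw [inner52_comm (E₂ u) v, inner52_comm (E₂ u) (φ u), i02 u hu]
    ring
  have hNf : ∀ v : E52, (∀ a : Plane, inner52 v (fderiv ℝ φ u₀ a) = 0) →
      inner52 v (φ u₀) = 0 → N v u₀ = v := by
    intro v h1 h2
    obtain ⟨o1, o2⟩ := ortho u₀ v fun i => h1 _
    simp only [hN, h2, o1, o2]
    module
  have n43 : inner52 f.f₄ f.f₃ = -1 := by
    rw [inner52_comm]
    exact f.normal_34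
  have Np : N (f.f₃ + f.f₄) u₀ = f.f₃ + f.f₄ := hNf _
    (fun a => by rw [inner52_add_left, f.normal_3, f.normal_4, add_zero])
    (by rw [inner52_add_left, f.normal_3_pos, f.normal_4_pos, add_zero])
  have Nm : N (f.f₃ - f.f₄) u₀ = f.f₃ - f.f₄ := hNf _
    (fun a => by rw [inner52_sub_left, f.normal_3, f.normal_4, sub_zero])
    (by rw [inner52_sub_left, f.normal_3_pos, f.normal_4_pos, sub_zero])
  obtain ⟨V', p', q', r', s', hVo', hVV', hu₀V', sp', sq', sr', ss', hF⟩ :=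
    exists_null_basis hVo (sN (f.f₃ + f.f₄)) (sN (f.f₃ - f.f₄)) hu₀V
      (by
        rw [Np]
        simp only [inner52_add_left, inner52_add_right, f.normal_33, f.normal_34, n43, f.normal_44]
        norm_num)
      (by
        rw [Np, Nm]
        simp only [inner52_add_left, inner52_sub_right, f.normal_33, f.normal_34, n43, f.normal_44]
        norm_num)
      (by
        rw [Nm]
        simp only [inner52_sub_left, inner52_sub_right, f.normal_33, f.normal_34, n43, f.normal_44]
        norm_num)
  have comb : ∀ (a b : ℝ) (v w z : E52) (u : Plane), inner52 z (N v u) = 0 →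
      inner52 z (N w u) = 0 → inner52 z (a • N v u + b • N w u) = 0 := by
    intro a b v w z u h1 h2
    rw [inner52_add_right, inner52_smul_right, inner52_smul_right, h1, h2]
    ring
  have frame : IsNullFrame φ E₁ E₂
      (fun u => p' u • N (f.f₃ + f.f₄) u + q' u • N (f.f₃ - f.f₄) u)
      (fun u => r' u • N (f.f₃ + f.f₄) u + s' u • N (f.f₃ - f.f₄) u) V' :=
    { isOpen := hVo'
      smooth := sφV.mono hVV'
      smooth₁ := sE₁.mono hVV'
      smooth₂ := sE₂.mono hVV'
      smooth₃ := (sp'.smul ((sN _).mono hVV')).add (sq'.smul ((sN _).mono hVV'))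
      smooth₄ := (sr'.smul ((sN _).mono hVV')).add (ss'.smul ((sN _).mono hVV'))
      inner_00 := fun u hu => i00 u (hVV' hu)
      inner_01 := fun u hu => i01 u (hVV' hu)
      inner_02 := fun u hu => i02 u (hVV' hu)
      inner_03 := fun u hu => comb _ _ _ _ _ u (N0 _ u (hVV' hu)) (N0 _ u (hVV' hu))
      inner_04 := fun u hu => comb _ _ _ _ _ u (N0 _ u (hVV' hu)) (N0 _ u (hVV' hu))
      inner_11 := fun u hu => i11 u (hVV' hu)
      inner_12 := fun u hu => i12 u (hVV' hu)
      inner_22 := fun u hu => i22 u (hVV' hu)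
      inner_13 := fun u hu => comb _ _ _ _ _ u (N1 _ u (hVV' hu)) (N1 _ u (hVV' hu))
      inner_14 := fun u hu => comb _ _ _ _ _ u (N1 _ u (hVV' hu)) (N1 _ u (hVV' hu))
      inner_23 := fun u hu => comb _ _ _ _ _ u (N2 _ u (hVV' hu)) (N2 _ u (hVV' hu))
      inner_24 := fun u hu => comb _ _ _ _ _ u (N2 _ u (hVV' hu)) (N2 _ u (hVV' hu))
      inner_33 := fun u hu => (hF u hu).1
      inner_34 := fun u hu => (hF u hu).2.1
      inner_44 := fun u hu => (hF u hu).2.2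
      normal₃ := fun u hu => hdual u (hVV' hu) _
        (by
          rw [inner52_comm]
          exact comb _ _ _ _ _ u (N1 _ u (hVV' hu)) (N1 _ u (hVV' hu)))
        (by
          rw [inner52_comm]
          exact comb _ _ _ _ _ u (N2 _ u (hVV' hu)) (N2 _ u (hVV' hu)))
      normal₄ := fun u hu => hdual u (hVV' hu) _
        (by
          rw [inner52_comm]
          exact comb _ _ _ _ _ u (N1 _ u (hVV' hu)) (N1 _ u (hVV' hu)))
        (by
          rw [inner52_comm]
          exact comb _ _ _ _ _ u (N2 _ u (hVV' hu)) (N2 _ u (hVV' hu)))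
      coframe_ne := fun u hu => left_ne_zero_of_mul_eq_one (hJ u (hVV' hu)) }
  generalize (fun u => p' u • N (f.f₃ + f.f₄) u + q' u • N (f.f₃ - f.f₄) u) = F₃ at frame
  generalize (fun u => r' u • N (f.f₃ + f.f₄) u + s' u • N (f.f₃ - f.f₄) u) = F₄ at frame
  have shrink : ∀ G₃ G₄ : Plane → E52, IsNullFrame φ E₁ E₂ G₃ G₄ V' →
      0 < (Matrix.of ![E₁ u₀, E₂ u₀, G₃ u₀, G₄ u₀, φ u₀] : Matrix (Fin 5) (Fin 5) ℝ).det →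
      ∃ (U : Set Plane) (E₁ E₂ F₃ F₄ : Plane → E52), U ⊆ W ∧ u₀ ∈ U ∧
      IsNullFrame φ E₁ E₂ F₃ F₄ U ∧
      ∀ u ∈ U, 0 < (Matrix.of ![E₁ u, E₂ u, F₃ u, F₄ u, φ u] :
        Matrix (Fin 5) (Fin 5) ℝ).det := by
    intro G₃ G₄ hG hpos
    exact ⟨V' ∩ _, E₁, E₂, G₃, G₄, fun u hu => hVW (hVV' hu.1), ⟨hu₀V', hpos⟩,
      hG.mono ((continuousOn_frameDet hG).isOpen_inter_preimage hVo' (isOpen_Ioi (a := 0)))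
        Set.inter_subset_left, fun u hu => hu.2⟩
  -- one of the two orders of `F₃, F₄` is positive at `u₀`, and then nearby
  rcases (frameDet_ne_zero frame hu₀V').lt_or_gt with hlt | hgt
  · exact shrink F₄ F₃ frame.swap (by rw [det_swap_frame]; linarith)
  · exact shrink F₃ F₄ frame hgt

/-! ### Change of coordinates -/

/-- The Jacobian determinant of a coordinate change. -/
noncomputable def jacobian (τ : Plane → Plane) (u : Plane) : ℝ :=
  pd 0 τ u 0 * pd 1 τ u 1 - pd 0 τ u 1 * pd 1 τ u 0

theorem jacobian_eq_det (τ : Plane → Plane) (u : Plane) :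
    jacobian τ u = (fderiv ℝ τ u).det := by
  rw [ContinuousLinearMap.det,
    ← LinearMap.det_toMatrix (EuclideanSpace.basisFun (Fin 2) ℝ).toBasis, Matrix.det_fin_two]
  simp [LinearMap.toMatrix_apply, jacobian, pd]
  ring

/-- Reparametrization of a surface and of vector fields along it: on `T`, the field `A'` is the
field `A` in the new coordinates, and the connection form is the pull-back. -/
theorem conn_comp {A B A' : Plane → E52} {τ : Plane → Plane} {U T : Set Plane} (hU : IsOpen U)
    (hT : IsOpen T) (hA : ContDiffOn ℝ ∞ A U) (hτ : ContDiffOn ℝ ∞ τ T) (hm : Set.MapsTo τ T U)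
    (hA' : ∀ u ∈ T, A' u = A (τ u)) {u : Plane} (hu : u ∈ T) (i : Fin 2) :
    conn A' (B ∘ τ) i u
      = pd i τ u 0 * conn A B 0 (τ u) + pd i τ u 1 * conn A B 1 (τ u) := by
  have d1 := differentiableAt_of_contDiffOn hU hA (hm hu)
  have d2 := differentiableAt_of_contDiffOn hT hτ hu
  have e : pd i A' u = fderiv ℝ A (τ u) (pd i τ u) := by
    rw [pd_congr (G := A ∘ τ) i (Filter.eventually_of_mem (hT.mem_nhds hu) hA'), pd,
      fderiv_comp u d1 d2]
    rfl
  rw [conn, e, fderiv_apply_eq_sum_pd, inner52_add_left, inner52_smul_left, inner52_smul_left]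
  simp only [conn, Function.comp]
  ring

namespace IsNullFrame

variable {φ ψ E₁ E₂ F₃ F₄ : Plane → E52} {τ : Plane → Plane} {U T : Set Plane}

theorem wedge_comp (h : IsNullFrame φ E₁ E₂ F₃ F₄ U) (hT : IsOpen T)
    (hτ : ContDiffOn ℝ ∞ τ T) (hm : Set.MapsTo τ T U)
    {A B C D A' C' : Plane → E52} (hA : ContDiffOn ℝ ∞ A U) (hC : ContDiffOn ℝ ∞ C U)
    (hA' : ∀ u ∈ T, A' u = A (τ u)) (hC' : ∀ u ∈ T, C' u = C (τ u)) {u : Plane} (hu : u ∈ T) :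
    wedge (conn A' (B ∘ τ)) (conn C' (D ∘ τ)) u
      = jacobian τ u * wedge (conn A B) (conn C D) (τ u) := by
  simp only [wedge, conn_comp h.isOpen hT hA hτ hm hA' hu, conn_comp h.isOpen hT hC hτ hm hC' hu,
    jacobian]
  ring

/-- A null frame in new coordinates. -/
theorem comp (h : IsNullFrame φ E₁ E₂ F₃ F₄ U) (hT : IsOpen T)
    (hτ : ContDiffOn ℝ ∞ τ T) (hm : Set.MapsTo τ T U) (hψ : ∀ u ∈ T, ψ u = φ (τ u))
    (hj : ∀ u ∈ T, jacobian τ u ≠ 0) :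
    IsNullFrame ψ (E₁ ∘ τ) (E₂ ∘ τ) (F₃ ∘ τ) (F₄ ∘ τ) T where
  isOpen := hT
  smooth := (h.smooth.comp hτ hm).congr hψ
  smooth₁ := h.smooth₁.comp hτ hm
  smooth₂ := h.smooth₂.comp hτ hm
  smooth₃ := h.smooth₃.comp hτ hm
  smooth₄ := h.smooth₄.comp hτ hm
  inner_00 := fun u hu => by rw [hψ u hu]; exact h.inner_00 _ (hm hu)
  inner_01 := fun u hu => by rw [hψ u hu]; exact h.inner_01 _ (hm hu)
  inner_02 := fun u hu => by rw [hψ u hu]; exact h.inner_02 _ (hm hu)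
  inner_03 := fun u hu => by rw [hψ u hu]; exact h.inner_03 _ (hm hu)
  inner_04 := fun u hu => by rw [hψ u hu]; exact h.inner_04 _ (hm hu)
  inner_11 := fun u hu => h.inner_11 _ (hm hu)
  inner_12 := fun u hu => h.inner_12 _ (hm hu)
  inner_22 := fun u hu => h.inner_22 _ (hm hu)
  inner_13 := fun u hu => h.inner_13 _ (hm hu)
  inner_14 := fun u hu => h.inner_14 _ (hm hu)
  inner_23 := fun u hu => h.inner_23 _ (hm hu)
  inner_24 := fun u hu => h.inner_24 _ (hm hu)
  inner_33 := fun u hu => h.inner_33 _ (hm hu)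
  inner_34 := fun u hu => h.inner_34 _ (hm hu)
  inner_44 := fun u hu => h.inner_44 _ (hm hu)
  normal₃ := fun u hu i => by
    have e := conn_comp (B := F₃) h.isOpen hT h.smooth hτ hm hψ hu i
    rw [h.conn_03 (hm hu), h.conn_03 (hm hu), mul_zero, mul_zero, add_zero, conn,
      neg_eq_zero] at e
    exact e
  normal₄ := fun u hu i => by
    have e := conn_comp (B := F₄) h.isOpen hT h.smooth hτ hm hψ hu i
    rw [h.conn_04 (hm hu), h.conn_04 (hm hu), mul_zero, mul_zero, add_zero, conn,
      neg_eq_zero] at e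
    exact e
  coframe_ne := fun u hu => by
    rw [h.wedge_comp hT hτ hm h.smooth h.smooth hψ hψ hu]
    exact mul_ne_zero (hj u hu) (h.coframe_ne _ (hm hu))

theorem shape_comp (h : IsNullFrame φ E₁ E₂ F₃ F₄ U) (hT : IsOpen T)
    (hτ : ContDiffOn ℝ ∞ τ T) (hm : Set.MapsTo τ T U) (hψ : ∀ u ∈ T, ψ u = φ (τ u))
    {u : Plane} (hu : u ∈ T) (hj : jacobian τ u ≠ 0) (F : Plane → E52) :
    shape ψ (E₁ ∘ τ) (E₂ ∘ τ) (F ∘ τ) u = shape φ E₁ E₂ F (τ u) := by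
  rw [shape, shape,
    h.wedge_comp hT hτ hm (A' := E₁ ∘ τ) h.smooth₁ h.smooth
      (fun _ _ => rfl) hψ hu,
    h.wedge_comp hT hτ hm h.smooth h.smooth hψ hψ hu, mul_div_mul_left _ _ hj]

theorem mixedVanishes_comp (h : IsNullFrame φ E₁ E₂ F₃ F₄ U) (hT : IsOpen T)
    (hτ : ContDiffOn ℝ ∞ τ T) (hm : Set.MapsTo τ T U) (hψ : ∀ u ∈ T, ψ u = φ (τ u))
    {u : Plane} (hu : u ∈ T) (hj : jacobian τ u ≠ 0) {F : Plane → E52}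
    (hv : MixedVanishes ψ (E₁ ∘ τ) (E₂ ∘ τ) (F ∘ τ) u) : MixedVanishes φ E₁ E₂ F (τ u) := by
  obtain ⟨h1, h2⟩ := hv
  rw [h.wedge_comp hT hτ hm (A' := E₁ ∘ τ) h.smooth₁ h.smooth
      (fun _ _ => rfl) hψ hu] at h1
  rw [h.wedge_comp hT hτ hm (A' := E₂ ∘ τ) h.smooth₂ h.smooth
      (fun _ _ => rfl) hψ hu] at h2
  exact ⟨(mul_eq_zero.1 h1).resolve_left hj, (mul_eq_zero.1 h2).resolve_left hj⟩

end IsNullFrame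

theorem nonempty_posNullFrame_of_normalK_ne_zero {φ : Plane → E52} {u : Plane}
    (h : normalK φ u ≠ 0) : Nonempty (PosNullFrame φ u) := by
  by_contra hn
  exact h (by rw [normalK, dif_neg hn])

theorem contDiffOn_param {M : Type*} [TopologicalSpace M] [ChartedSpace Plane M]
    [IsManifold (𝓡 2) ∞ M] {x : M → E52} (hx : ContMDiff (𝓡 2) 𝓘(ℝ, E52) ∞ x) (p : M) :
    ContDiffOn ℝ ∞ (param x p) (chartAt Plane p).target := by
  rw [← contMDiffOn_iff_contDiffOn]
  exact hx.comp_contMDiffOn (contMDiffOn_chart_symm (I := 𝓡 2) (x := p))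

end LorentzSurface

open LorentzSurface in
theorem corollary3p6 {M : Type*} [TopologicalSpace M] [ChartedSpace LorentzSurface.Plane M]
    [IsManifold (𝓡 2) ∞ M] [Nonempty M] (hor : LorentzSurface.IsOriented M)
    (x : M → LorentzSurface.E52) (hx : LorentzSurface.IsLorentzianSurface x)
    (hmin : LorentzSurface.IsMinimal x) (K KD : ℝ)
    (hK : ∀ p, LorentzSurface.gaussianCurvature x p = K)
    (hKD : ∀ p, LorentzSurface.normalCurvature x p = KD) (hKD0 : KD ≠ 0) :
    K = 1 / 3 ∧ |KD| = 2 / 3 := by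
  obtain ⟨p⟩ := ‹Nonempty M›
  have hne : ∀ q, Nonempty (PosNullFrame (param x q) (chartAt Plane q q)) := fun q =>
    nonempty_posNullFrame_of_normalK_ne_zero (by
      have h := hKD q
      rw [normalCurvature] at h
      rwa [h])
  obtain ⟨f⟩ := hne p
  obtain ⟨U, E₁, E₂, F₃, F₄, hUW, hpU, hf, hdet⟩ := exists_nullFrame (chartAt Plane p).open_target
    (contDiffOn_param hx.smooth p) (fun u _ => hx.mem_S42 _) (mem_chart_target Plane p) f
  -- at each point of `U` the curvatures are those of the chart at that point of the surface
  have key : ∀ v ∈ U, MixedVanishes (param x p) E₁ E₂ F₃ v ∧ MixedVanishes (param x p) E₁ E₂ F₄ v ∧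
      1 + shape (param x p) E₁ E₂ F₄ v * shape (param x p) E₂ E₁ F₃ v
        + shape (param x p) E₁ E₂ F₃ v * shape (param x p) E₂ E₁ F₄ v = K ∧
      shape (param x p) E₁ E₂ F₄ v * shape (param x p) E₂ E₁ F₃ v
        - shape (param x p) E₁ E₂ F₃ v * shape (param x p) E₂ E₁ F₄ v = KD := by
    intro v hv
    set e₀ := chartAt Plane p
    set q := e₀.symm v with hq
    set e := chartAt Plane q
    set u := e q with hu
    set τ : Plane → Plane := e₀ ∘ e.symm with hτ
    have hqs : q ∈ e₀.source := e₀.map_target (hUW hv)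
    have hus : u ∈ (e.symm.trans e₀).source := by
      rw [OpenPartialHomeomorph.trans_source]
      refine ⟨mem_chart_target Plane q, ?_⟩
      rw [Set.mem_preimage, hu, e.left_inv (mem_chart_source Plane q)]
      exact hqs
    have hτu : τ u = v := by
      rw [hτ, Function.comp, hu, e.left_inv (mem_chart_source Plane q), hq,
        e₀.right_inv (hUW hv)]
    set T : Set Plane := (e.symm.trans e₀).source ∩ τ ⁻¹' U
    have hT : IsOpen T := (e.symm.trans e₀).isOpen_inter_preimage hf.isOpen
    have huT : u ∈ T := ⟨hus, by rw [Set.mem_preimage, hτu]; exact hv⟩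
    have hτs : ContDiffOn ℝ ∞ τ T := by
      rw [← contMDiffOn_iff_contDiffOn]
      refine (contMDiffOn_chart (I := 𝓡 2) (x := p)).comp
        ((contMDiffOn_chart_symm (I := 𝓡 2) (x := q)).mono fun w hw => ?_) fun w hw => ?_
      · exact (e.symm.trans_source e₀ ▸ hw.1).1
      · exact (e.symm.trans_source e₀ ▸ hw.1).2
    have hm : Set.MapsTo τ T U := fun w hw => hw.2
    have hψ : ∀ w ∈ T, param x q w = param x p (τ w) := by
      intro w hw
      have h2 : e.symm w ∈ e₀.source := (e.symm.trans_source e₀ ▸ hw.1).2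
      show x (e.symm w) = x (e₀.symm (e₀ (e.symm w)))
      rw [e₀.left_inv h2]
    have hj : ∀ w ∈ T, jacobian τ w ≠ 0 := by
      intro w hw
      rw [jacobian_eq_det]
      exact (hor e (chart_mem_atlas Plane q) e₀ (chart_mem_atlas Plane p) w hw.1).ne'
    have hfT := hf.comp hT hτs hm hψ hj
    have hju := hj u huT
    have m₃ := hfT.mixedVanishes huT (hmin q)
    have m₄ := hfT.swap.mixedVanishes huT (hmin q)
    have hdetT : 0 < (Matrix.of ![(E₁ ∘ τ) u, (E₂ ∘ τ) u, (F₃ ∘ τ) u, (F₄ ∘ τ) u,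
        param x q u]).det := by
      rw [hψ u huT]
      exact hdet (τ u) (hm huT)
    have k1 := hfT.gaussK_eq huT m₃ m₄
    have k2 := hfT.normalK_eq huT hdetT (hne q) m₃ m₄
    have k1' : gaussK (param x q) u = K := hK q
    have k2' : normalK (param x q) u = KD := hKD q
    simp only [hf.shape_comp hT hτs hm hψ huT hju, hf.swapTangent.shape_comp hT hτs hm hψ huT hju,
      hτu] at k1 k2
    rw [← hτu]
    refine ⟨hf.mixedVanishes_comp hT hτs hm hψ huT hju m₃,
      hf.mixedVanishes_comp hT hτs hm hψ huT hju m₄, ?_, ?_⟩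
    · rw [hτu, ← k1, k1']
    · rw [hτu, ← k2, k2']
  exact hf.curvatures_eq (fun v hv => (key v hv).1) (fun v hv => (key v hv).2.1)
    (fun v hv => (key v hv).2.2.1) (fun v hv => (key v hv).2.2.2) hKD0 hpU
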